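/- **Machines.** Let $A$ be a finite input alphabet. A probabilistic Turing machine (PTM) has a read-only two-way input tape holding the input $w\in A^*$ between two end-markers (which the input head never leaves), one two-way infinite work tape, finitely many states, and a transition function giving the probability $\delta(q,\sigma,\gamma,q',d,\gamma',e)$ of entering state $q'$, writing $\gamma'$ on the work tape and moving the input and work heads by $d,e\in\{\text{left},\text{stationary},\text{right}\}$ when in state $q$ and scanning $\sigma$ and $\gamma$; for fixed $(q,\sigma,\gamma)$ these probabilities sum to $1$. A quantum Turing machine (QTM) has real amplitudes $\delta(q,\sigma,\gamma,q',d,\gamma',e,\omega)$, where $\omega$ is written in a finite register; if $E_\omega$ denotes the induced matrix on the configurations reachable on a given input, then $\sum_\omega E_\omega^\dagger E_\omega=I$ for every input. All transition probabilities and amplitudes are reals that are computable to within $2^{-n}$ in deterministic time polynomial in $n$. The states (and for a QTM also the register symbols) are partitioned according to the move outcomes, the initial state being a continuing one, and (for a QTM) a move from a continuing state always enters a state of the same outcome as the register symbol it writes. The outcomes are *continue*, *accept*, *reject* for standard machines, and *continue*, *postselection accept*, *postselection reject*, *nonpostselection halt* for machines with postselection. A PTM halts when it enters a non-continuing state; for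 a QTM the outcome of the register symbol is measured after every move, the machine halts if it is not *continue*, and otherwise the register is irreversibly reset. A machine runs in time $T$ if on every input $w$ it halts within $T(|w|)$ moves with certainty (on all computation paths). **Recognition.** A standard machine recognizes $L$ *nondeterministically* if $w\in L\iff \Pr[w\text{ is accepted}]>0$. For a machine with postselection let $p^a(w)$, $p^r(w)$ be the probabilities of halting with outcome postselection accept, postselection reject. It is required that $p^a(w)+p^r(w)>0$ for all $w$; the machine accepts $w$ with probability $p^a(w)/(p^a(w)+p^r(w))$ and rejects it with probability $p^r(w)/(p^a(w)+p^r(w))$. It recognizes $L$ *without error* if it accepts every $w\in L$ and rejects every $w\notin L$ with probability $1$. **Classes.** For $t:\mathbb N\to\mathbb N$, $\mathsf{NTIME}(t)$ (resp. $\mathsf{NQTIME}(t)$) is the class of languages over $A$ recognized nondeterministically by PTMs (resp. QTMs) running in time $O(t)$, and $\mathsf{PostEPTIME}(t)$ (resp. $\mathsf{PostEQTIME}(t)$) is the class of languages over $A$ recognized without error by PTMs (resp. QTMs) with postselection running in time $O(t)$. A real-time probabilistic (resp. quantum) finite automaton has a finite state set, starts in a fixed initial state, reads the input with its end-markers from left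 to right, applies for each symbol a stochastic matrix (resp. a superoperator $\rho\mapsto\sum_i E_i\rho E_i^\dagger$, $\sum_iE_i^\dagger E_i=I$), with arbitrary real entries, and determines the outcome from its state at the end of the input. $\mathsf{NQAL}$ is the class of languages recognized nondeterministically by real-time quantum finite automata; $\mathsf{PostES}$ (resp. $\mathsf{PostEQAL}$) is the class of languages recognized without error by real-time probabilistic (resp. quantum) finite automata with postselection; $\mathsf{REG}$ is the class of regular languages. For a class $\mathsf C$, $\mathsf{coC}=\{L\subseteq A^* : A^*\setminus L\in\mathsf C\}$. **Theorem.** For every time bound $t:\mathbb N\to\mathbb N$, $$\mathsf{PostEPTIME}(t)=\mathsf{NTIME}(t)\cap\mathsf{coNTIME}(t),\qquad \mathsf{PostEQTIME}(t)=\mathsf{NQTIME}(t)\cap\mathsf{coNQTIME}(t).$$ Moreover, $$\mathsf{PostES}=\mathsf{REG},\qquad \mathsf{PostEQAL}=\mathsf{NQAL}\cap\mathsf{coNQAL}.$$ -/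

import Mathlib

open scoped Matrix BigOperators

namespace Postselection

/-! ### Tapes, head moves, configurations -/

/-- Symbols on the input tape: the two end-markers and the letters of the input alphabet. -/
inductive InSym (A : Type*) where
  | leftEnd : InSym A
  | letter : A → InSym A
  | rightEnd : InSym A

/-- Head moves. -/
inductive Dir where
  | left
  | stationary
  | right
  deriving DecidableEq

instance : Fintype Dir where
  elems := {.left, .stationary, .right}
  complete d := by cases d <;> simp

/-- The displacement of a head move. -/
def Dir.shift : Dir → ℤ
  | .left => -1
  | .stationary => 0
  | .right => 1

/-- The symbol in cell `p` of the input tape holding `w` between end-markers: the left end-marker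
is in cell `0`, the letters are in cells `1, …, |w|`, the right end-marker is in cell `|w| + 1`.
(The values outside `[0, |w| + 1]` are irrelevant: the machines below never leave this range.) -/
def inputSym {A : Type*} (w : List A) (p : ℤ) : InSym A :=
  if p ≤ 0 then .leftEnd
  else match w[(p - 1).toNat]? with
    | some a => .letter a
    | none => .rightEnd

/-- The whole string read by a real-time machine on input `w`. -/
def endMarked {A : Type*} (w : List A) : List (InSym A) :=
  .leftEnd :: (w.map .letter ++ [.rightEnd])

/-- A configuration: internal state, positions of the input and work tape heads, and contents of
the (two-way infinite) work tape. -/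
@[ext]
structure Config (Q G : Type) where
  state : Q
  inPos : ℤ
  workPos : ℤ
  tape : ℤ → G

/-- The initial configuration: both heads in cell `0`, blank work tape. -/
def Config.init {Q G : Type} (q : Q) (blank : G) : Config Q G :=
  ⟨q, 0, 0, fun _ => blank⟩

/-- Change the state to `q`, write `g` on the scanned work cell, move the heads by `d` and `e`. -/
def Config.next {Q G : Type} (c : Config Q G) (q : Q) (d : Dir) (g : G) (e : Dir) : Config Q G :=
  ⟨q, c.inPos + d.shift, c.workPos + e.shift, Function.update c.tape c.workPos g⟩

/-- The set of reals `p` that a deterministic algorithm computes to within `2⁻ⁿ` in time polynomial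
in `n`: on input `n` in unary, a (multi-stack) Turing machine outputs a natural number `f n` in
binary such that `± f n / 2ⁿ` is the approximation; the sign depends on `p` only. -/
def EffReal : Set ℝ :=
  {p | ∃ (s : ℤˣ) (f : ℕ → ℕ),
    Nonempty (Turing.TM2ComputableInPolyTime Computability.unaryEncodeNat
      Computability.encodeNat f) ∧
    ∀ n : ℕ, |p - ((s : ℤ) : ℝ) * ((f n : ℝ) / 2 ^ n)| ≤ 1 / 2 ^ n}

/-! ### Outcomes and modes of recognition

The set of move outcomes of a machine is `Option H`: `none` is the outcome "continue", and
`some h` is the halting outcome `h`. -/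

/-- Halting outcomes of standard machines. -/
inductive Std where
  | accept
  | reject
  deriving DecidableEq

/-- Halting outcomes of machines with postselection: postselection accept, postselection reject,
nonpostselection halting. -/
inductive Post where
  | accept
  | reject
  | nonpost
  deriving DecidableEq

/-- `L` is recognized with strict cutpoint `lam`, where `acc w` is the acceptance probability. -/
def RecognizesWithCutpoint {A : Type*} (acc : List A → ℝ) (lam : ℝ) (L : Language A) : Prop :=
  ∀ w, w ∈ L ↔ lam < acc w

/-- `L` is recognized with error bound `ε`, where `acc w` and `rej w` are the acceptance and
rejection probabilities. -/
def RecognizesWithError {A : Type*} (acc rej : List A → ℝ) (ε : ℝ) (L : Language A) : Prop :=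
  (∀ w, w ∈ L → 1 - ε ≤ acc w) ∧ (∀ w, w ∉ L → 1 - ε ≤ rej w)

/-- Recognition with cutpoint `0` by a standard machine that halts with outcome `h` on input `w`
with probability `p h w`. -/
def NondetRecognizes {A : Type*} (p : Std → List A → ℝ) (L : Language A) : Prop :=
  RecognizesWithCutpoint (p .accept) 0 L

/-- Acceptance probability after postselection. -/
noncomputable def postAccProb {A : Type*} (p : Post → List A → ℝ) (w : List A) : ℝ :=
  p .accept w / (p .accept w + p .reject w)

/-- Rejection probability after postselection. -/
noncomputable def postRejProb {A : Type*} (p : Post → List A → ℝ) (w : List A) : ℝ :=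
  p .reject w / (p .accept w + p .reject w)

/-- Error-free recognition by a machine with postselection that halts with outcome `h` on input `w`
with probability `p h w`. A machine with postselection is required to reach a postselection state
with nonzero probability on every input. -/
def PostErrorFreeRecognizes {A : Type*} (p : Post → List A → ℝ) (L : Language A) : Prop :=
  (∀ w, 0 < p .accept w + p .reject w) ∧
    RecognizesWithError (postAccProb p) (postRejProb p) 0 L

/-! ### Probabilistic Turing machines -/

/-- The data of a probabilistic Turing machine with input alphabet `A` and halting outcomes `H`.
`δ q σ γ q' d γ' e` is the probability of changing the state to `q'`, writing `γ'` on the work tape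
and moving the input and work heads by `d` and `e`, when in state `q` and scanning `σ` and `γ`. -/
structure PTM (A : Type*) (H : Type) where
  /-- internal states -/
  Q : Type
  /-- work tape alphabet -/
  G : Type
  [finQ : Fintype Q]
  [finG : Fintype G]
  blank : G
  start : Q
  δ : Q → InSym A → G → Q → Dir → G → Dir → ℝ
  /-- the partition of the states according to the outcomes -/
  outcome : Q → Option H

namespace PTM

variable {A : Type*} {H : Type} (M : PTM A H)

instance : Fintype M.Q := M.finQ
instance : Fintype M.G := M.finG

/-- The conditions on the transition function and on the initial state. -/
structure WellFormed : Prop where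
  eff : ∀ q σ γ q' d γ' e, M.δ q σ γ q' d γ' e ∈ EffReal
  nonneg : ∀ q σ γ q' d γ' e, 0 ≤ M.δ q σ γ q' d γ' e
  sum_eq_one : ∀ q σ γ, ∑ q', ∑ d, ∑ γ', ∑ e, M.δ q σ γ q' d γ' e = 1
  /-- the input head does not leave the area delimited by the end-markers -/
  left_end : ∀ q γ q' γ' e, M.δ q .leftEnd γ q' .left γ' e = 0
  right_end : ∀ q γ q' γ' e, M.δ q .rightEnd γ q' .right γ' e = 0
  start_continuing : M.outcome M.start = none

/-- The column of the configuration transition matrix on input `w` that belongs to `c`. -/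
noncomputable def column (w : List A) (c : Config M.Q M.G) : Config M.Q M.G →₀ ℝ :=
  ∑ q', ∑ d, ∑ γ', ∑ e, Finsupp.single (c.next q' d γ' e)
    (M.δ c.state (inputSym w c.inPos) (c.tape c.workPos) q' d γ' e)

variable [DecidableEq H]

/-- One move of the computation paths that have not yet halted. -/
noncomputable def step (w : List A) (v : Config M.Q M.G →₀ ℝ) : Config M.Q M.G →₀ ℝ :=
  v.sum fun c a => if M.outcome c.state = none then a • M.column w c else 0

/-- `dist w k c` is the probability that the machine makes at least `k` moves on input `w` and is in
configuration `c` after the `k`-th move. -/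
noncomputable def dist (w : List A) : ℕ → (Config M.Q M.G →₀ ℝ)
  | 0 => Finsupp.single (Config.init M.start M.blank) 1
  | k + 1 => M.step w (dist w k)

/-- The probability that the machine halts with outcome `h` on input `w`. -/
noncomputable def haltProb (h : H) (w : List A) : ℝ :=
  ∑' k, (M.dist w k).sum fun c a => if M.outcome c.state = some h then a else 0

/-- For every input `w`, all computation paths (of nonzero probability) halt within `T |w|` moves. -/
def RunsInTime (T : ℕ → ℕ) : Prop :=
  ∀ w : List A, ∀ c ∈ (M.dist w (T w.length)).support, M.outcome c.state ≠ none

end PTM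

/-! ### Quantum Turing machines -/

/-- The data of a quantum Turing machine with input alphabet `A` and halting outcomes `H`.
`δ q σ γ q' d γ' e ω` is the amplitude of changing the state to `q'`, writing `γ'` on the work tape
and `ω` in the finite register, and moving the input and work heads by `d` and `e`, when in state
`q` and scanning `σ` and `γ`. -/
structure QTM (A : Type*) (H : Type) where
  /-- internal states -/
  Q : Type
  /-- work tape alphabet -/
  G : Type
  /-- register symbols -/
  R : Type
  [finQ : Fintype Q]
  [finG : Fintype G]
  [finR : Fintype R]
  blank : G
  start : Q
  /-- the symbol to which the register is reset before every move -/
  startReg : R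
  δ : Q → InSym A → G → Q → Dir → G → Dir → R → ℝ
  /-- the partition of the states according to the outcomes -/
  outcome : Q → Option H
  /-- the partition of the register symbols according to the outcomes -/
  regOutcome : R → Option H

namespace QTM

variable {A : Type*} {H : Type} (M : QTM A H)

instance : Fintype M.Q := M.finQ
instance : Fintype M.G := M.finG
instance : Fintype M.R := M.finR

/-- The column of the matrix `E_ω` on input `w` that belongs to the configuration `c`. -/
noncomputable def column (w : List A) (ω : M.R) (c : Config M.Q M.G) : Config M.Q M.G →₀ ℝ :=
  ∑ q', ∑ d, ∑ γ', ∑ e, Finsupp.single (c.next q' d γ' e)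
    (M.δ c.state (inputSym w c.inPos) (c.tape c.workPos) q' d γ' e ω)

/-- The configurations that can be reached on input `w` by transitions of nonzero amplitude. -/
inductive Reachable (w : List A) : Config M.Q M.G → Prop
  | init : Reachable w (Config.init M.start M.blank)
  | move (c c' : Config M.Q M.G) (ω : M.R) :
      Reachable w c → M.column w ω c c' ≠ 0 → Reachable w c'

/-- The `(c, c')` entry of the matrix `∑ ω, E_ω† E_ω` on input `w` (the amplitudes are real). -/
noncomputable def gram (w : List A) (c c' : Config M.Q M.G) : ℝ :=
  ∑ ω, (M.column w ω c).sum fun b a => a * M.column w ω c' b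

/-- The conditions on the transition function and on the initial state and register symbol. -/
structure WellFormed : Prop where
  eff : ∀ q σ γ q' d γ' e ω, M.δ q σ γ q' d γ' e ω ∈ EffReal
  /-- `∑ ω, E_ω† E_ω = I` over the reachable configurations, for every input -/
  gram_self : ∀ w c, M.Reachable w c → M.gram w c c = 1
  gram_ne : ∀ w c c', M.Reachable w c → M.Reachable w c' → c ≠ c' → M.gram w c c' = 0
  /-- the input head does not leave the area delimited by the end-markers -/
  left_end : ∀ q γ q' γ' e ω, M.δ q .leftEnd γ q' .left γ' e ω = 0
  right_end : ∀ q γ q' γ' e ω, M.δ q .rightEnd γ q' .right γ' e ω = 0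
  /-- in the moves that are performed, the state entered and the register symbol written belong to
  the same outcome -/
  consistent : ∀ q σ γ q' d γ' e ω, M.outcome q = none → M.δ q σ γ q' d γ' e ω ≠ 0 →
    M.outcome q' = M.regOutcome ω
  start_continuing : M.outcome M.start = none
  startReg_continuing : M.regOutcome M.startReg = none

/-- The operator `E_ω` on input `w`. -/
noncomputable def applyReg (w : List A) (ω : M.R) (v : Config M.Q M.G →₀ ℝ) :
    Config M.Q M.G →₀ ℝ :=
  v.sum fun c a => a • M.column w ω c

/-- The squared norm of a (not necessarily normalized) superposition of configurations. -/
noncomputable def normSq (v : Config M.Q M.G →₀ ℝ) : ℝ :=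
  v.sum fun _ a => a ^ 2

variable [DecidableEq H]

/-- `haltAt w h k v` is the probability that the machine, started in the unnormalized superposition
`v` on input `w`, continues for `k` moves and then halts with outcome `h` in move `k + 1`. After each
move the outcome is observed and the register is reset; resetting irreversibly discards the register
symbol `ω`, so the unnormalized branches `E_ω v` of one outcome form a classical mixture. -/
noncomputable def haltAt (w : List A) (h : H) : ℕ → (Config M.Q M.G →₀ ℝ) → ℝ
  | 0, v => ∑ ω, if M.regOutcome ω = some h then M.normSq (M.applyReg w ω v) else 0
  | k + 1, v => ∑ ω, if M.regOutcome ω = none then haltAt w h k (M.applyReg w ω v) else 0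

/-- `contAt w k v` is the probability that the machine, started in the unnormalized superposition
`v` on input `w`, has not halted after `k` moves. -/
noncomputable def contAt (w : List A) : ℕ → (Config M.Q M.G →₀ ℝ) → ℝ
  | 0, v => M.normSq v
  | k + 1, v => ∑ ω, if M.regOutcome ω = none then contAt w k (M.applyReg w ω v) else 0

/-- The initial superposition. -/
noncomputable def initVec : Config M.Q M.G →₀ ℝ :=
  Finsupp.single (Config.init M.start M.blank) 1

/-- The probability that the machine halts with outcome `h` on input `w`. -/
noncomputable def haltProb (h : H) (w : List A) : ℝ :=
  ∑' k, M.haltAt w h k M.initVec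

/-- For every input `w`, the machine halts within `T |w|` moves with certainty. -/
def RunsInTime (T : ℕ → ℕ) : Prop :=
  ∀ w : List A, M.contAt w (T w.length) M.initVec = 0

end QTM

/-! ### Real-time finite automata -/

/-- A real-time probabilistic finite automaton; `mat σ j i` is the probability of the transition
from state `i` to state `j` on reading `σ`. Arbitrary real probabilities are allowed. -/
structure PFA (A : Type*) (H : Type) where
  Q : Type
  [finQ : Fintype Q]
  [decQ : DecidableEq Q]
  start : Q
  mat : InSym A → Matrix Q Q ℝ
  /-- the outcome determined by the state in which the computation ends -/
  outcome : Q → H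
  nonneg : ∀ σ j i, 0 ≤ mat σ j i
  sum_eq_one : ∀ σ i, ∑ j, mat σ j i = 1

namespace PFA

variable {A : Type*} {H : Type} (M : PFA A H)

instance : Fintype M.Q := M.finQ
instance : DecidableEq M.Q := M.decQ

/-- The stochastic state vector at the end of the input. -/
noncomputable def finalVec (w : List A) : M.Q → ℝ :=
  (endMarked w).foldl (fun v σ => M.mat σ *ᵥ v) (Pi.single M.start 1)

/-- The probability that the computation on `w` ends in a state with outcome `h`. -/
noncomputable def haltProb [DecidableEq H] (h : H) (w : List A) : ℝ :=
  ∑ q, if M.outcome q = h then M.finalVec w q else 0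

end PFA

/-- A real-time quantum finite automaton; `kraus σ i` are the operation elements of the
superoperator applied on reading `σ`. Arbitrary real amplitudes are allowed. -/
structure QFA (A : Type*) (H : Type) where
  Q : Type
  [finQ : Fintype Q]
  [decQ : DecidableEq Q]
  start : Q
  /-- the number of operation elements -/
  num : InSym A → ℕ
  kraus : (σ : InSym A) → Fin (num σ) → Matrix Q Q ℝ
  /-- the outcome of the measurement of the state type at the end of the computation -/
  outcome : Q → H
  complete : ∀ σ, ∑ i, (kraus σ i)ᵀ * kraus σ i = 1

namespace QFA

variable {A : Type*} {H : Type} (M : QFA A H)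

instance : Fintype M.Q := M.finQ
instance : DecidableEq M.Q := M.decQ

/-- The density matrix at the end of the input. -/
noncomputable def finalDensity (w : List A) : Matrix M.Q M.Q ℝ :=
  (endMarked w).foldl (fun ρ σ => ∑ i, M.kraus σ i * ρ * (M.kraus σ i)ᵀ)
    (Matrix.single M.start M.start 1)

/-- The projection onto the span of the states with outcome `h`. -/
def proj [DecidableEq H] (h : H) : Matrix M.Q M.Q ℝ :=
  Matrix.diagonal fun q => if M.outcome q = h then 1 else 0

/-- The probability of observing the outcome `h` at the end of the computation on `w`. -/
noncomputable def haltProb [DecidableEq H] (h : H) (w : List A) : ℝ :=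
  (M.proj h * M.finalDensity w).trace

end QFA

/-! ### Language classes -/

/-- The complements of the languages of a class. -/
def co {A : Type*} (C : Set (Language A)) : Set (Language A) :=
  {L | Lᶜ ∈ C}

/-- `T = O(t)`. -/
def IsBigOTime (T t : ℕ → ℕ) : Prop :=
  (fun n => (T n : ℝ)) =O[Filter.atTop] (fun n => (t n : ℝ))

/-- Languages recognized with cutpoint `0` by probabilistic Turing machines in time `O(t)`. -/
def NTIME (A : Type*) (t : ℕ → ℕ) : Set (Language A) :=
  {L | ∃ (M : PTM A Std) (T : ℕ → ℕ), M.WellFormed ∧ IsBigOTime T t ∧ M.RunsInTime T ∧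
    NondetRecognizes M.haltProb L}

/-- Languages recognized with cutpoint `0` by quantum Turing machines in time `O(t)`. -/
def NQTIME (A : Type*) (t : ℕ → ℕ) : Set (Language A) :=
  {L | ∃ (M : QTM A Std) (T : ℕ → ℕ), M.WellFormed ∧ IsBigOTime T t ∧ M.RunsInTime T ∧
    NondetRecognizes M.haltProb L}

/-- Languages recognized without error by probabilistic Turing machines with postselection in time
`O(t)`. -/
def PostEPTIME (A : Type*) (t : ℕ → ℕ) : Set (Language A) :=
  {L | ∃ (M : PTM A Post) (T : ℕ → ℕ), M.WellFormed ∧ IsBigOTime T t ∧ M.RunsInTime T ∧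
    PostErrorFreeRecognizes M.haltProb L}

/-- Languages recognized without error by quantum Turing machines with postselection in time
`O(t)`. -/
def PostEQTIME (A : Type*) (t : ℕ → ℕ) : Set (Language A) :=
  {L | ∃ (M : QTM A Post) (T : ℕ → ℕ), M.WellFormed ∧ IsBigOTime T t ∧ M.RunsInTime T ∧
    PostErrorFreeRecognizes M.haltProb L}

/-- The regular languages. -/
def REG (A : Type*) : Set (Language A) :=
  {L | L.IsRegular}

/-- Languages recognized with cutpoint `0` by real-time quantum finite automata. -/
def NQAL (A : Type*) : Set (Language A) :=
  {L | ∃ M : QFA A Std, NondetRecognizes M.haltProb L}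

/-- Languages recognized without error by real-time probabilistic finite automata with
postselection. -/
def PostES (A : Type*) : Set (Language A) :=
  {L | ∃ M : PFA A Post, PostErrorFreeRecognizes M.haltProb L}

/-- Languages recognized without error by real-time quantum finite automata with postselection. -/
def PostEQAL (A : Type*) : Set (Language A) :=
  {L | ∃ M : QFA A Post, PostErrorFreeRecognizes M.haltProb L}

end Postselection

/-! Error-free postselection means that on every input exactly one of the two postselection outcomes
has positive probability: `w ∈ L` iff postselection acceptance is possible, and `w ∉ L` iff
postselection rejection is possible (`PostErrorFreeRecognizes.mem_iff`,
`PostErrorFreeRecognizes.mem_compl_iff`). Making either outcome the only accepting one therefore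
gives nondeterministic recognition of `L` or of its complement, without changing the dynamics.

Conversely, take nondeterministic machines for `L` and for its complement. The machine `choice`
tosses a fair coin and runs one of them. Acceptance by the first becomes postselection acceptance,
acceptance by the second becomes postselection rejection, and every other halt is discarded. Each
outcome probability is half the original acceptance probability (`haltProb_choice`), so exactly one
is positive. The toss costs one move, which the sum of the two time bounds covers.

A quantum toss in superposition would have amplitudes `1/√2`, whose efficient computability would
need an argument. Instead each machine is chosen with amplitude `1/2` under two different register
symbols. Discarding the register makes these branches a classical mixture, and each machine receives
weight `2 · (1/2)² = 1/2`.

For probabilistic automata, the set of states of positive probability evolves deterministically,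
which is the subset construction. For quantum automata the two recognizers run in parallel as a
tensor product (`QFA.haltProb_prod`). The one that cannot accept `w` rejects with probability 1, so
the joint probability of its rejection and the other's acceptance is just the latter's acceptance
probability. -/

namespace Postselection

/-! ### Efficiently computable reals -/

/-- Such a number has only ones in binary, so its binary code coincides with the unary code of `n`.
This makes approximations of `1 / 2` computable with almost no work. -/
lemma encodeNat_two_pow_sub_one (n : ℕ) :
    Computability.encodeNat (2 ^ n - 1) = List.replicate n true := by
  have key : ∀ n : ℕ, ∃ p : PosNum, ((p : ℕ) = 2 ^ (n + 1) - 1) ∧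
      Computability.encodePosNum p = List.replicate (n + 1) true := by
    intro n
    induction n with
    | zero => exact ⟨1, by simp, rfl⟩
    | succ n ih =>
      obtain ⟨p, hp, he⟩ := ih
      refine ⟨p.bit1, ?_, ?_⟩
      · rw [PosNum.cast_bit1, hp]
        have : 1 ≤ 2 ^ (n + 1) := Nat.one_le_two_pow
        rw [pow_succ 2 (n + 1)]
        omega
      · rw [Computability.encodePosNum, he, ← List.replicate_succ]
  cases n with
  | zero => rfl
  | succ n =>
    obtain ⟨p, hp, he⟩ := key n
    have h : ((p : ℕ) : Num) = Num.pos p := PosNum.of_to_nat p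
    rw [← hp, Computability.encodeNat, h, Computability.encodeNum, he]

lemma unaryEncodeNat_eq_replicate (n : ℕ) :
    Computability.unaryEncodeNat n = List.replicate n true := by
  induction n with
  | zero => rfl
  | succ n ih => rw [Computability.unaryEncodeNat, ih, List.replicate_succ]

/-- The machine with a single stack that removes the top symbol of the stack and halts. -/
def popComputer : Turing.FinTM2 where
  K := Unit
  k₀ := ⟨⟩
  k₁ := ⟨⟩
  Γ _ := Bool
  Λ := Unit
  main := ⟨⟩
  σ := Unit
  initialState := ⟨⟩
  m _ := Turing.TM2.Stmt.pop () (fun s _ => s) Turing.TM2.Stmt.halt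

lemma half_mem_EffReal : (1 / 2 : ℝ) ∈ EffReal := by
  -- Rather than the exact numerator `2 ^ (n - 1)`, its predecessor is output: its code is the unary
  -- input with one symbol removed, and the error is exactly `2⁻ⁿ` for `n ≥ 1`. For `n = 0`,
  -- truncated subtraction gives the value `0`, with error `1 / 2 ≤ 1`.
  refine ⟨1, fun n => 2 ^ (n - 1) - 1, ⟨?_⟩, fun n => ?_⟩
  · refine ⟨⟨popComputer, Equiv.refl Bool, Equiv.refl Bool⟩, 1, fun n => ⟨⟨1, ?_⟩, ?_⟩⟩
    · rw [Function.iterate_one, unaryEncodeNat_eq_replicate, encodeNat_two_pow_sub_one]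
      change some (Turing.TM2.Cfg.mk _ _ _) = some (Turing.TM2.Cfg.mk _ _ _)
      congr 2
      funext k
      obtain ⟨⟩ := k
      cases n <;> rfl
    · simp
  · cases n with
    | zero => norm_num
    | succ n =>
      have h : (1 : ℕ) ≤ 2 ^ n := Nat.one_le_two_pow
      have h2 : (0 : ℝ) < 2 ^ n := by positivity
      simp only [Nat.add_sub_cancel, Units.val_one, Int.cast_one, one_mul]
      rw [Nat.cast_sub h]
      push_cast
      rw [pow_succ, show (1 / 2 : ℝ) - (2 ^ n - 1) / (2 ^ n * 2) = 1 / (2 ^ n * 2) by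
        field_simp; ring, abs_of_pos (by positivity)]

/-! ### Sums over the transitions of a machine -/

/-- The transition functions of `choice` are extensions by zero along injective encodings. Sums over
the large transition set thus collapse to sums over the simulated machine. -/
lemma sum_extend_zero {ι κ E N : Type*} [Fintype ι] [Fintype κ] [AddCommMonoid E] [Zero N]
    {f : ι → κ} (hf : Function.Injective f) (g : ι → N) (F : κ → N → E) (hF : ∀ x, F x 0 = 0) :
    ∑ x, F x (Function.extend f g 0 x) = ∑ y, F (f y) (g y) := by
  refine (Fintype.sum_of_injective f hf _ _ (fun x hx => ?_) fun y => ?_).symm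
  · rw [Function.extend_apply' _ _ _ (by simpa using hx), Pi.zero_apply, hF]
  · rw [hf.extend_apply]

lemma extend_zero_induction {ι κ N : Type*} [Zero N] {f : ι → κ} (hf : Function.Injective f)
    {g : ι → N} {P : N → Prop} (h0 : P 0) (h : ∀ y, P (g y)) (x : κ) :
    P (Function.extend f g 0 x) := by
  by_cases hx : ∃ y, f y = x
  · obtain ⟨y, rfl⟩ := hx
    rw [hf.extend_apply]
    exact h y
  · rw [Function.extend_apply' _ _ _ hx]
    exact h0

/-- A simulated move encodes the state and the written symbol jointly and leaves the head moves
alone, so the former are grouped as a pair and the latter stay outside. The initial toss fixes all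
four components, whence the fully grouped variant `sum_transitions_prod`. -/
lemma sum_transitions {Q G E : Type*} [Fintype Q] [Fintype G] [AddCommMonoid E]
    (F : Q → Dir → G → Dir → E) :
    ∑ q, ∑ d, ∑ g, ∑ e, F q d g e = ∑ d, ∑ e, ∑ x : Q × G, F x.1 d x.2 e := by
  simp_rw [Fintype.sum_prod_type]
  rw [Finset.sum_comm]
  refine Finset.sum_congr rfl fun d _ => ?_
  exact (Finset.sum_congr rfl fun q _ => Finset.sum_comm).trans Finset.sum_comm

lemma sum_transitions_prod {Q G E : Type*} [Fintype Q] [Fintype G] [AddCommMonoid E]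
    (F : Q → Dir → G → Dir → E) :
    ∑ q, ∑ d, ∑ g, ∑ e, F q d g e =
      ∑ x : Q × Dir × G × Dir, F x.1 x.2.1 x.2.2.1 x.2.2.2 := by
  simp_rw [Fintype.sum_prod_type]

/-! ### Simulation of one of two machines -/

/-- The configuration of a machine with state set `Option (Σ b, Q b)` that simulates the machine
with index `b`, using the track with index `b` of the work tape. -/
def Config.embed {Q G : Bool → Type} (blank : ∀ b, G b) (b : Bool) (c : Config (Q b) (G b)) :
    Config (Option (Σ b, Q b)) (∀ b, G b) :=
  ⟨some ⟨b, c.state⟩, c.inPos, c.workPos, fun i => Function.update blank b (c.tape i)⟩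

section Embed

variable {Q G : Bool → Type} (blank : ∀ b, G b)

lemma Config.embed_injective (b : Bool) :
    Function.Injective (Config.embed (Q := Q) blank b) := by
  rintro ⟨q, p, x, t⟩ ⟨q', p', x', t'⟩ h
  simp only [Config.embed, Config.mk.injEq, Option.some.injEq, Sigma.mk.injEq, heq_eq_eq,
    true_and] at h ⊢
  refine ⟨h.1, h.2.1, h.2.2.1, funext fun i => ?_⟩
  simpa using congrFun (congrFun h.2.2.2 i) b

lemma Config.embed_next (b : Bool) (c : Config (Q b) (G b)) (r : Q b) (d : Dir) (g : G b)
    (e : Dir) :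
    (Config.embed blank b c).next (some ⟨b, r⟩) d
      (Function.update ((Config.embed blank b c).tape c.workPos) b g) e =
      Config.embed blank b (c.next r d g e) := by
  simp only [Config.embed, Config.next, Config.mk.injEq, true_and]
  funext i
  by_cases h : i = c.workPos
  · subst h; simp
  · simp [h]

lemma Config.init_next_stationary {Q' G' : Type} (q q' : Q') (g : G') :
    (Config.init q g).next q' .stationary g .stationary = Config.init q' g := by
  simp [Config.init, Config.next, Dir.shift]

lemma Config.embed_init (b : Bool) (q : Q b) :
    Config.embed blank b (Config.init q (blank b)) = Config.init (some ⟨b, q⟩) blank := by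
  simp [Config.init, Config.embed]

end Embed

/-! ### Probabilistic Turing machines: relabelling of outcomes and the fair choice of a machine -/

namespace PTM

variable {A : Type*} {H H' : Type}

/-- Apply `f` to the halting outcomes. -/
def relabel (f : H → H') (M : PTM A H) : PTM A H' where
  Q := M.Q
  G := M.G
  blank := M.blank
  start := M.start
  δ := M.δ
  outcome q := (M.outcome q).map f

/-- The machine that in its first move chooses one of two machines with equal probability, and then
simulates it on its own track of the work tape. -/
noncomputable def choice (M : Bool → PTM A H) : PTM A H where
  Q := Option (Σ b, (M b).Q)
  G := ∀ b, (M b).G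
  blank b := (M b).blank
  start := none
  δ q σ γ q' d γ' e := match q with
    | none => Function.extend
        (fun b => ((some ⟨b, (M b).start⟩, Dir.stationary, γ, Dir.stationary) :
          Option (Σ b, (M b).Q) × Dir × (∀ b, (M b).G) × Dir))
        (fun _ => (1 / 2 : ℝ)) 0 (q', d, γ', e)
    | some ⟨b, q⟩ => Function.extend
        (fun x : (M b).Q × (M b).G =>
          ((some ⟨b, x.1⟩, Function.update γ b x.2) : Option (Σ b, (M b).Q) × (∀ b, (M b).G)))
        (fun x => (M b).δ q σ (γ b) x.1 d x.2 e) 0 (q', γ')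
  outcome
    | none => none
    | some ⟨b, q⟩ => (M b).outcome q

/-- The transitions of the first move of `choice M`. -/
def choiceStart (M : Bool → PTM A H) (γ : ∀ b, (M b).G) (b : Bool) :
    (choice M).Q × Dir × (choice M).G × Dir :=
  (some ⟨b, (M b).start⟩, .stationary, γ, .stationary)

/-- The state and the work tape symbol of `choice M` that belong to those of `M b`. -/
def choiceMove (M : Bool → PTM A H) (γ : ∀ b, (M b).G) (b : Bool) (x : (M b).Q × (M b).G) :
    (choice M).Q × (choice M).G :=
  (some ⟨b, x.1⟩, Function.update γ b x.2)

lemma choiceStart_injective (M : Bool → PTM A H) (γ : ∀ b, (M b).G) :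
    Function.Injective (choiceStart M γ) := by
  intro b b' h
  exact congrArg Sigma.fst (Option.some.inj (congrArg Prod.fst h))

lemma choiceMove_injective (M : Bool → PTM A H) (γ : ∀ b, (M b).G) (b : Bool) :
    Function.Injective (choiceMove M γ b) := by
  rintro ⟨q, g⟩ ⟨q', g'⟩ h
  have h1 := congrArg Prod.fst h
  have h2 := congrFun (congrArg Prod.snd h) b
  simp only [choiceMove, Function.update_self] at h2
  exact Prod.ext (eq_of_heq (Sigma.mk.inj (Option.some.inj h1)).2) h2

/-- Moving left from the left end-marker has probability `0`, and every transition probability is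
efficiently computable; no algorithm for `0` has to be exhibited. -/
lemma WellFormed.zero_mem {M : PTM A H} (hM : M.WellFormed) : (0 : ℝ) ∈ EffReal := by
  have h := hM.eff M.start .leftEnd M.blank M.start .left M.blank .left
  rwa [hM.left_end] at h

lemma WellFormed.relabel {M : PTM A H} (hM : M.WellFormed) (f : H → H') :
    (M.relabel f).WellFormed where
  eff := hM.eff
  nonneg := hM.nonneg
  sum_eq_one := hM.sum_eq_one
  left_end := hM.left_end
  right_end := hM.right_end
  start_continuing := by simp [PTM.relabel, hM.start_continuing]

lemma WellFormed.choice {M : Bool → PTM A H} (hM : ∀ b, (M b).WellFormed) :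
    (choice M).WellFormed where
  eff q σ γ q' d γ' e := by
    rcases q with _ | ⟨b, q⟩
    · exact extend_zero_induction (choiceStart_injective M γ) (hM true).zero_mem
        (fun _ => half_mem_EffReal) (q', d, γ', e)
    · exact extend_zero_induction (choiceMove_injective M γ b) (hM true).zero_mem
        (fun _ => (hM b).eff _ _ _ _ _ _ _) (q', γ')
  nonneg q σ γ q' d γ' e := by
    rcases q with _ | ⟨b, q⟩
    · exact extend_zero_induction (P := fun x : ℝ => 0 ≤ x) (g := fun _ => 1 / 2)
        (choiceStart_injective M γ) le_rfl (fun _ => by norm_num) (q', d, γ', e)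
    · exact extend_zero_induction (P := fun x : ℝ => 0 ≤ x) (choiceMove_injective M γ b) le_rfl
        (fun _ => (hM b).nonneg _ _ _ _ _ _ _) (q', γ')
  sum_eq_one q σ γ := by
    rcases q with _ | ⟨b, q⟩
    · rw [sum_transitions_prod]
      have h := sum_extend_zero (choiceStart_injective M γ) (fun _ => (1 / 2 : ℝ)) (fun _ a => a)
        (fun _ => rfl)
      exact h.trans (by simp)
    · rw [sum_transitions, ← (hM b).sum_eq_one q σ (γ b), sum_transitions]
      exact Finset.sum_congr rfl fun d _ => Finset.sum_congr rfl fun e _ =>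
        sum_extend_zero (choiceMove_injective M γ b)
          (fun x => (M b).δ q σ (γ b) x.1 d x.2 e) (fun _ a => a) (fun _ => rfl)
  left_end q γ q' γ' e := by
    rcases q with _ | ⟨b, q⟩
    · refine Function.extend_apply' (f := choiceStart M γ) (fun _ => 1 / 2) 0
        (q', Dir.left, γ', e) ?_
      rintro ⟨b, h⟩
      exact Dir.noConfusion (congrArg (fun x => x.2.1) h)
    · exact extend_zero_induction (P := fun x : ℝ => x = 0) (choiceMove_injective M γ b) rfl
        (fun _ => (hM b).left_end _ _ _ _ _) (q', γ')
  right_end q γ q' γ' e := by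
    rcases q with _ | ⟨b, q⟩
    · refine Function.extend_apply' (f := choiceStart M γ) (fun _ => 1 / 2) 0
        (q', Dir.right, γ', e) ?_
      rintro ⟨b, h⟩
      exact Dir.noConfusion (congrArg (fun x => x.2.1) h)
    · exact extend_zero_induction (P := fun x : ℝ => x = 0) (choiceMove_injective M γ b) rfl
        (fun _ => (hM b).right_end _ _ _ _ _) (q', γ')
  start_continuing := rfl

/-! ### Linearity and positivity of the classical evolution; consequences of a time bound -/

lemma step_eq_linearCombination (M : PTM A H) (w : List A) (v : Config M.Q M.G →₀ ℝ) :
    M.step w v = Finsupp.linearCombination ℝ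
      (fun c => if M.outcome c.state = none then M.column w c else 0) v := by
  simp only [step, Finsupp.linearCombination_apply, smul_ite, smul_zero]

/-- The total weight of the configurations with outcome `h`. -/
noncomputable def haltWeight [DecidableEq H] (M : PTM A H) (h : H) : (Config M.Q M.G →₀ ℝ) →ₗ[ℝ] ℝ :=
  Finsupp.linearCombination ℝ (fun c => if M.outcome c.state = some h then 1 else 0)

lemma haltProb_eq_tsum [DecidableEq H] (M : PTM A H) (h : H) (w : List A) :
    M.haltProb h w = ∑' k, M.haltWeight h (M.dist w k) := by
  simp [haltProb, haltWeight, Finsupp.linearCombination_apply]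

lemma column_nonneg {M : PTM A H} (hM : M.WellFormed) (w : List A) (c : Config M.Q M.G) :
    0 ≤ M.column w c :=
  Finset.sum_nonneg fun _ _ => Finset.sum_nonneg fun _ _ => Finset.sum_nonneg fun _ _ =>
    Finset.sum_nonneg fun _ _ => Finsupp.single_nonneg.2 (hM.nonneg _ _ _ _ _ _ _)

lemma dist_nonneg {M : PTM A H} (hM : M.WellFormed) (w : List A) (k : ℕ) : 0 ≤ M.dist w k := by
  induction k with
  | zero => exact Finsupp.single_nonneg.2 zero_le_one
  | succ k ih =>
    refine Finset.sum_nonneg fun c _ => ?_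
    dsimp only
    split_ifs
    · exact smul_nonneg (ih c) (column_nonneg hM w c)
    · exact le_rfl

lemma haltProb_nonneg [DecidableEq H] {M : PTM A H} (hM : M.WellFormed) (h : H) (w : List A) :
    0 ≤ M.haltProb h w := by
  refine tsum_nonneg fun k => Finset.sum_nonneg fun c _ => ?_
  dsimp only
  split_ifs
  · exact dist_nonneg hM w k c
  · exact le_rfl

lemma step_eq_zero {M : PTM A H} {w : List A} {v : Config M.Q M.G →₀ ℝ}
    (hv : ∀ c ∈ v.support, M.outcome c.state ≠ none) : M.step w v = 0 :=
  Finset.sum_eq_zero fun c hc => if_neg (hv c hc)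

lemma dist_add_eq_zero {M : PTM A H} {T : ℕ → ℕ} (hT : M.RunsInTime T) (w : List A) (k : ℕ) :
    M.dist w (T w.length + 1 + k) = 0 := by
  induction k with
  | zero => exact step_eq_zero (hT w)
  | succ k ih =>
    rw [← add_assoc, dist, ih]
    exact step_eq_zero (by simp)

/-- Beyond the bound the distribution is zero, so the time condition persists at all later times.
This allows a machine to be inspected at a time that exceeds its own bound. -/
lemma RunsInTime.outcome_ne {M : PTM A H} {T : ℕ → ℕ} (hT : M.RunsInTime T) {w : List A} {k : ℕ}
    (hk : T w.length ≤ k) {c : Config M.Q M.G} (hc : c ∈ (M.dist w k).support) :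
    M.outcome c.state ≠ none := by
  rcases hk.eq_or_lt with rfl | hk
  · exact hT w c hc
  · obtain ⟨j, rfl⟩ := Nat.exists_eq_add_of_lt hk
    rw [add_right_comm, dist_add_eq_zero hT] at hc
    simp at hc

lemma RunsInTime.pos {M : PTM A H} (hM : M.WellFormed) {T : ℕ → ℕ} (hT : M.RunsInTime T)
    (w : List A) : 0 < T w.length := by
  rcases Nat.eq_zero_or_pos (T w.length) with h | h
  · exact absurd hM.start_continuing
      (hT.outcome_ne (w := w) h.le (c := Config.init M.start M.blank) (by simp [dist]))
  · exact h

lemma RunsInTime.summable [DecidableEq H] {M : PTM A H} {T : ℕ → ℕ} (hT : M.RunsInTime T) (h : H) (w : List A) :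
    Summable fun k => M.haltWeight h (M.dist w k) := by
  refine summable_of_ne_finset_zero (s := Finset.range (T w.length + 1)) fun k hk => ?_
  rw [Finset.mem_range, not_lt] at hk
  obtain ⟨j, rfl⟩ := Nat.exists_eq_add_of_le hk
  rw [dist_add_eq_zero hT, map_zero]

section Relabel

variable (M : PTM A H) (f : H → H')

/-- The evolution only asks whether an outcome is `none`, which `Option.map` preserves. -/
lemma dist_relabel (w : List A) (k : ℕ) : (M.relabel f).dist w k = M.dist w k := by
  induction k with
  | zero => rfl
  | succ k ih =>
    rw [dist, ih]
    refine Finset.sum_congr rfl fun c _ => ?_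
    simp only [relabel, Option.map_eq_none_iff]
    rfl

lemma RunsInTime.relabel {M : PTM A H} {T : ℕ → ℕ} (hT : M.RunsInTime T) (f : H → H') :
    (M.relabel f).RunsInTime T := by
  intro w c hc
  rw [dist_relabel] at hc
  simpa [PTM.relabel] using hT w c hc

lemma haltProb_relabel [DecidableEq H] [DecidableEq H'] {h : H} (hf : ∀ x, f x = f h → x = h) (w : List A) :
    (M.relabel f).haltProb (f h) w = M.haltProb h w := by
  refine tsum_congr fun k => ?_
  rw [dist_relabel]
  refine Finset.sum_congr rfl fun c _ => ?_
  have : (M.relabel f).outcome c.state = some (f h) ↔ M.outcome c.state = some h := by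
    simp only [relabel, Option.map_eq_some_iff]
    exact ⟨fun ⟨x, hx, hx'⟩ => hf x hx' ▸ hx, fun hx => ⟨h, hx, rfl⟩⟩
  simp only [this]
  rfl

lemma haltProb_relabel_eq_zero [DecidableEq H'] {h' : H'} (hf : ∀ x, f x ≠ h') (w : List A) :
    (M.relabel f).haltProb h' w = 0 := by
  refine (tsum_congr fun k => Finset.sum_eq_zero fun c _ => if_neg ?_).trans tsum_zero
  simp [relabel, hf]

end Relabel

section Choice

variable (M : Bool → PTM A H)

/-- The configuration of `choice M` that simulates the machine `M b` in configuration `c`. -/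
abbrev embed (b : Bool) : Config (M b).Q (M b).G → Config (choice M).Q (choice M).G :=
  Config.embed (Q := fun b => (M b).Q) (fun b => (M b).blank) b

lemma column_choice_embed (w : List A) (b : Bool) (c : Config (M b).Q (M b).G) :
    (choice M).column w (embed M b c) = ((M b).column w c).mapDomain (embed M b) := by
  rw [column, column, sum_transitions, sum_transitions, Finsupp.mapDomain_finsetSum]
  refine Finset.sum_congr rfl fun d _ => ?_
  rw [Finsupp.mapDomain_finsetSum]
  refine Finset.sum_congr rfl fun e _ => ?_
  rw [Finsupp.mapDomain_finsetSum]
  have h := sum_extend_zero (choiceMove_injective M ((embed M b c).tape c.workPos) b)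
    (fun x => (M b).δ c.state (inputSym w c.inPos) ((embed M b c).tape c.workPos b) x.1 d x.2 e)
    (fun x a => Finsupp.single ((embed M b c).next x.1 d x.2 e) a)
    (fun _ => Finsupp.single_zero _)
  refine h.trans (Finset.sum_congr rfl fun x _ => ?_)
  rw [Finsupp.mapDomain_single]
  congr 1
  · exact Config.embed_next (Q := fun b => (M b).Q) (fun b => (M b).blank) b c x.1 d x.2 e
  · simp [Config.embed]

lemma column_choice_init (w : List A) :
    (choice M).column w (Config.init none (fun b => (M b).blank)) =
      ∑ b, Finsupp.single (embed M b (Config.init (M b).start (M b).blank)) (1 / 2) := by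
  rw [column, sum_transitions_prod]
  have h := sum_extend_zero (choiceStart_injective M fun b => (M b).blank)
    (fun _ => (1 / 2 : ℝ))
    (fun x a => Finsupp.single ((Config.init (none : (choice M).Q) fun b => (M b).blank).next
      x.1 x.2.1 x.2.2.1 x.2.2.2) a) (fun _ => Finsupp.single_zero _)
  refine h.trans (Finset.sum_congr rfl fun b _ => ?_)
  congr 1
  exact (Config.init_next_stationary _ _ _).trans
    (Config.embed_init (Q := fun b => (M b).Q) (fun b => (M b).blank) b _).symm

lemma step_choice_mapDomain (w : List A) (b : Bool) (v : Config (M b).Q (M b).G →₀ ℝ) :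
    (choice M).step w (v.mapDomain (embed M b)) = ((M b).step w v).mapDomain (embed M b) := by
  rw [step_eq_linearCombination, step_eq_linearCombination, Finsupp.linearCombination_mapDomain,
    ← Finsupp.lmapDomain_apply ℝ ℝ, Finsupp.apply_linearCombination]
  congr 2
  funext c
  simp only [Function.comp_apply, column_choice_embed, apply_ite (Finsupp.lmapDomain ℝ ℝ _),
    Finsupp.lmapDomain_apply, map_zero]
  rfl

/-- The toss produces the half-half mixture of the two embedded initial configurations; afterwards
`step` is linear and commutes with each embedding. -/
lemma dist_choice_succ (w : List A) (k : ℕ) :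
    (choice M).dist w (k + 1) =
      ∑ b, (1 / 2 : ℝ) • ((M b).dist w k).mapDomain (embed M b) := by
  induction k with
  | zero =>
    rw [dist, dist, step_eq_linearCombination, Finsupp.linearCombination_single, one_smul]
    refine (if_pos rfl).trans ((column_choice_init M w).trans ?_)
    simp [dist]
  | succ k ih =>
    rw [dist, ih, step_eq_linearCombination, map_sum]
    refine Finset.sum_congr rfl fun b _ => ?_
    rw [map_smul, ← step_eq_linearCombination, step_choice_mapDomain]
    rfl

lemma haltWeight_choice_mapDomain [DecidableEq H] (h : H) (b : Bool) (v : Config (M b).Q (M b).G →₀ ℝ) :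
    (choice M).haltWeight h (v.mapDomain (embed M b)) = (M b).haltWeight h v := by
  rw [haltWeight, Finsupp.linearCombination_mapDomain]
  rfl

variable {M}

lemma RunsInTime.choice (hM : ∀ b, (M b).WellFormed) {T : Bool → ℕ → ℕ}
    (hT : ∀ b, (M b).RunsInTime (T b)) :
    (choice M).RunsInTime fun n => T true n + T false n := by
  intro w c (hc : c ∈ ((PTM.choice M).dist w (T true w.length + T false w.length)).support)
  have h1 := (hT true).pos (hM true) w
  have h2 := (hT false).pos (hM false) w
  -- One move is spent on the toss. As both bounds are positive, the remaining `k` moves still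
  -- suffice for either machine.
  obtain ⟨k, hk⟩ : ∃ k, T true w.length + T false w.length = k + 1 :=
    ⟨T true w.length + T false w.length - 1, by omega⟩
  rw [hk, dist_choice_succ] at hc
  classical
  obtain ⟨b, -, hb⟩ := Finset.mem_biUnion.1 (Finsupp.support_finsetSum hc)
  obtain ⟨c', hc', rfl⟩ := Finset.mem_image.1
    (Finsupp.mapDomain_support (Finsupp.support_smul hb))
  exact (hT b).outcome_ne (w := w) (k := k) (by cases b <;> omega) hc'

lemma haltProb_choice [DecidableEq H] {T : Bool → ℕ → ℕ} (hT : ∀ b, (M b).RunsInTime (T b)) (h : H)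
    (w : List A) :
    (choice M).haltProb h w = ((M true).haltProb h w + (M false).haltProb h w) / 2 := by
  have h0 : (choice M).haltWeight h ((choice M).dist w 0) = 0 := by
    rw [dist, haltWeight, Finsupp.linearCombination_single, if_neg, smul_zero]
    exact fun h' => Option.some_ne_none h h'.symm
  have hs : ∀ k, (choice M).haltWeight h ((choice M).dist w (k + 1)) =
      1 / 2 * (M true).haltWeight h ((M true).dist w k) +
        1 / 2 * (M false).haltWeight h ((M false).dist w k) := fun k => by
    rw [dist_choice_succ, map_sum, Fintype.sum_bool]
    simp only [map_smul, haltWeight_choice_mapDomain, smul_eq_mul]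
  have hsum := ((hT true).summable h w).mul_left (1 / 2)
  have hsum' := ((hT false).summable h w).mul_left (1 / 2)
  simp only [haltProb_eq_tsum]
  -- The initial state is continuing, so the zeroth term vanishes and the series is the shifted
  -- average. Summability of the whole series is inherited from that shift.
  rw [((summable_nat_add_iff 1).1 ((hsum.add hsum').congr fun k => (hs k).symm)).tsum_eq_zero_add,
    h0, zero_add, tsum_congr hs, hsum.tsum_add hsum', tsum_mul_left, tsum_mul_left]
  ring

end Choice

end PTM

/-! ### Quantum Turing machines: relabelling of outcomes and the choice of a machine -/

namespace QTM

variable {A : Type*} {H H' : Type}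

/-- Apply `f` to the halting outcomes. -/
def relabel (f : H → H') (M : QTM A H) : QTM A H' where
  Q := M.Q
  G := M.G
  R := M.R
  blank := M.blank
  start := M.start
  startReg := M.startReg
  δ := M.δ
  outcome q := (M.outcome q).map f
  regOutcome ω := (M.regOutcome ω).map f

/-- The machine that in its first move chooses one of two machines with equal probability, and then
simulates it on its own track of the work tape. In the first move each of the two machines is chosen
with amplitude `1 / 2` together with each of two register symbols. -/
noncomputable def choice (M : Bool → QTM A H) : QTM A H where
  Q := Option (Σ b, (M b).Q)
  G := ∀ b, (M b).G
  R := (Bool × Bool) ⊕ (Σ b, (M b).R)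
  blank b := (M b).blank
  start := none
  startReg := .inl (true, true)
  δ q σ γ q' d γ' e ω := match q, ω with
    | none, .inl (b, _) => Function.extend
        (fun _ : Unit => ((some ⟨b, (M b).start⟩, Dir.stationary, γ, Dir.stationary) :
          Option (Σ b, (M b).Q) × Dir × (∀ b, (M b).G) × Dir))
        (fun _ => (1 / 2 : ℝ)) 0 (q', d, γ', e)
    | none, .inr _ => 0
    | some _, .inl _ => 0
    | some ⟨b, q⟩, .inr ⟨b', ω⟩ => if h : b' = b then Function.extend
        (fun x : (M b).Q × (M b).G =>
          ((some ⟨b, x.1⟩, Function.update γ b x.2) : Option (Σ b, (M b).Q) × (∀ b, (M b).G)))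
        (fun x => (M b).δ q σ (γ b) x.1 d x.2 e (h ▸ ω)) 0 (q', γ') else 0
  outcome
    | none => none
    | some ⟨b, q⟩ => (M b).outcome q
  regOutcome
    | .inl _ => none
    | .inr ⟨b, ω⟩ => (M b).regOutcome ω

/-- The register symbols written by `choice M` in its first move. -/
def tossReg (M : Bool → QTM A H) (b i : Bool) : (choice M).R := Sum.inl (b, i)

/-- The register symbols written by `choice M` when it simulates `M b`. -/
def simReg (M : Bool → QTM A H) (b : Bool) (ω : (M b).R) : (choice M).R := Sum.inr ⟨b, ω⟩

lemma choice_reg_cases (M : Bool → QTM A H) (ω : (choice M).R) :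
    (∃ b i, ω = tossReg M b i) ∨ ∃ b ω', ω = simReg M b ω' := by
  rcases ω with ⟨b, i⟩ | ⟨b, ω⟩
  exacts [.inl ⟨b, i, rfl⟩, .inr ⟨b, ω, rfl⟩]

/-- The transition of the first move of `choice M` that chooses `M b`. -/
def choiceStart (M : Bool → QTM A H) (γ : ∀ b, (M b).G) (b : Bool) (_ : Unit) :
    (choice M).Q × Dir × (choice M).G × Dir :=
  (some ⟨b, (M b).start⟩, .stationary, γ, .stationary)

/-- The state and the work tape symbol of `choice M` that belong to those of `M b`. -/
def choiceMove (M : Bool → QTM A H) (γ : ∀ b, (M b).G) (b : Bool) (x : (M b).Q × (M b).G) :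
    (choice M).Q × (choice M).G :=
  (some ⟨b, x.1⟩, Function.update γ b x.2)

lemma choiceStart_injective (M : Bool → QTM A H) (γ : ∀ b, (M b).G) (b : Bool) :
    Function.Injective (choiceStart M γ b) := fun _ _ _ => rfl

lemma choiceMove_injective (M : Bool → QTM A H) (γ : ∀ b, (M b).G) (b : Bool) :
    Function.Injective (choiceMove M γ b) := by
  rintro ⟨q, g⟩ ⟨q', g'⟩ h
  have h1 := congrArg Prod.fst h
  have h2 := congrFun (congrArg Prod.snd h) b
  simp only [choiceMove, Function.update_self] at h2
  exact Prod.ext (eq_of_heq (Sigma.mk.inj (Option.some.inj h1)).2) h2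

/-! ### Columns, Gram matrix and reachable configurations of the quantum choice -/

section Choice

variable (M : Bool → QTM A H)

lemma choice_δ_toss (σ : InSym A) (γ γ' : (choice M).G) (q' : (choice M).Q) (d e : Dir)
    (b i : Bool) :
    (choice M).δ (none : Option (Σ b, (M b).Q)) σ γ q' d γ' e
      (tossReg M b i) =
      Function.extend (choiceStart M γ b) (fun _ => (1 / 2 : ℝ)) 0 (q', d, γ', e) := rfl

lemma choice_δ_sim (σ : InSym A) (γ γ' : (choice M).G) (q' : (choice M).Q) (d e : Dir)
    (b : Bool) (q : (M b).Q) (ω : (M b).R) :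
    (choice M).δ (some ⟨b, q⟩ : Option (Σ b, (M b).Q)) σ γ q' d γ' e
      (simReg M b ω) =
      Function.extend (choiceMove M γ b) (fun x => (M b).δ q σ (γ b) x.1 d x.2 e ω) 0 (q', γ') :=
  dif_pos rfl

lemma choice_δ_sim_ne (σ : InSym A) (γ γ' : (choice M).G) (q' : (choice M).Q) (d e : Dir)
    {b b' : Bool} (h : b' ≠ b) (q : (M b).Q) (ω : (M b').R) :
    (choice M).δ (some ⟨b, q⟩ : Option (Σ b, (M b).Q)) σ γ q' d γ' e
      (simReg M b' ω) = 0 :=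
  dif_neg h

/-- A property of `0`, of `1 / 2` and of the amplitudes of the simulated machines holds for the
amplitudes of `choice M`. -/
lemma choice_δ_induction {P : ℝ → Prop} (q : (choice M).Q) (σ : InSym A) (γ γ' : (choice M).G)
    (q' : (choice M).Q) (d e : Dir) (ω : (choice M).R) (h0 : P 0)
    (hstart : ∀ b : Bool, q = none → q' = some ⟨b, (M b).start⟩ → d = .stationary →
      e = .stationary → (∃ i, ω = tossReg M b i) → P (1 / 2))
    (hmove : ∀ b q₀ r ω₀ g g', q = some ⟨b, q₀⟩ → q' = some ⟨b, r⟩ → ω = simReg M b ω₀ →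
      P ((M b).δ q₀ σ g r d g' e ω₀)) :
    P ((choice M).δ q σ γ q' d γ' e ω) := by
  rcases q with _ | ⟨b, q⟩ <;> rcases ω with ⟨b', i⟩ | ⟨b', ω⟩
  · erw [choice_δ_toss]
    by_cases hx : ∃ y, choiceStart M γ b' y = (q', d, γ', e)
    · obtain ⟨y, hy⟩ := hx
      rw [← hy, (choiceStart_injective M γ b').extend_apply]
      exact hstart b' rfl (congrArg (fun x => x.1) hy).symm (congrArg (fun x => x.2.1) hy).symm
        (congrArg (fun x => x.2.2.2) hy).symm ⟨i, rfl⟩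
    · rwa [Function.extend_apply' _ _ _ hx]
  · exact h0
  · exact h0
  · by_cases h : b' = b
    · subst h
      erw [choice_δ_sim]
      by_cases hx : ∃ y, choiceMove M γ b' y = (q', γ')
      · obtain ⟨y, hy⟩ := hx
        rw [← hy, (choiceMove_injective M γ b').extend_apply]
        exact hmove b' q y.1 ω _ _ rfl (congrArg (fun x => x.1) hy).symm rfl
      · rwa [Function.extend_apply' _ _ _ hx]
    · erw [choice_δ_sim_ne M σ γ γ' q' d e h]
      exact h0

/-- The configuration of `choice M` that simulates the machine `M b` in configuration `c`. -/
abbrev embed (b : Bool) : Config (M b).Q (M b).G → Config (choice M).Q (choice M).G :=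
  Config.embed (Q := fun b => (M b).Q) (fun b => (M b).blank) b

lemma embed_injective (b : Bool) : Function.Injective (embed M b) :=
  Config.embed_injective (Q := fun b => (M b).Q) (fun b => (M b).blank) b

lemma column_eq_zero {M : QTM A H} {w : List A} {ω : M.R} {c : Config M.Q M.G}
    (h : ∀ q' d γ' e,
      M.δ c.state (inputSym w c.inPos) (c.tape c.workPos) q' d γ' e ω = 0) :
    M.column w ω c = 0 := by
  simp [column, h]

lemma column_choice_embed_toss (w : List A) (b' i b : Bool)
    (c : Config (M b).Q (M b).G) : (choice M).column w (tossReg M b' i) (embed M b c) = 0 :=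
  column_eq_zero fun _ _ _ _ => rfl

lemma column_choice_embed_sim_ne (w : List A) {b b' : Bool} (h : b' ≠ b) (ω : (M b').R)
    (c : Config (M b).Q (M b).G) : (choice M).column w (simReg M b' ω) (embed M b c) = 0 :=
  column_eq_zero fun _ _ _ _ => choice_δ_sim_ne M _ _ _ _ _ _ h _ _

lemma column_choice_embed_sim (w : List A) (b : Bool) (ω : (M b).R) (c : Config (M b).Q (M b).G) :
    (choice M).column w (simReg M b ω) (embed M b c) =
      ((M b).column w ω c).mapDomain (embed M b) := by
  rw [column, column, sum_transitions, sum_transitions, Finsupp.mapDomain_finsetSum]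
  refine Finset.sum_congr rfl fun d _ => ?_
  rw [Finsupp.mapDomain_finsetSum]
  refine Finset.sum_congr rfl fun e _ => ?_
  rw [Finsupp.mapDomain_finsetSum]
  have h := sum_extend_zero (choiceMove_injective M ((embed M b c).tape c.workPos) b)
    (fun x => (M b).δ c.state (inputSym w c.inPos) ((embed M b c).tape c.workPos b) x.1 d x.2 e ω)
    (fun x a => Finsupp.single ((embed M b c).next x.1 d x.2 e) a)
    (fun _ => Finsupp.single_zero _)
  refine (Finset.sum_congr rfl fun x _ => ?_).trans
    (h.trans (Finset.sum_congr rfl fun x _ => ?_))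
  · exact congrArg _ (choice_δ_sim M _ _ _ _ _ _ _ _ _)
  · rw [Finsupp.mapDomain_single]
    congr 1
    · exact Config.embed_next (Q := fun b => (M b).Q) (fun b => (M b).blank) b c x.1 d x.2 e
    · simp [Config.embed]

lemma column_choice_init_sim (w : List A) (b : Bool) (ω : (M b).R) :
    (choice M).column w (simReg M b ω) (Config.init (choice M).start (choice M).blank) = 0 :=
  column_eq_zero fun _ _ _ _ => rfl

lemma column_choice_init_toss (w : List A) (b i : Bool) :
    (choice M).column w (tossReg M b i) (Config.init (choice M).start (choice M).blank) =
      Finsupp.single (embed M b (Config.init (M b).start (M b).blank)) (1 / 2) := by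
  rw [column, sum_transitions_prod]
  have h := sum_extend_zero (choiceStart_injective M (choice M).blank b)
    (fun _ => (1 / 2 : ℝ))
    (fun x a => Finsupp.single ((Config.init (choice M).start (choice M).blank).next
      x.1 x.2.1 x.2.2.1 x.2.2.2) a) (fun _ => Finsupp.single_zero _)
  refine h.trans ((Fintype.sum_unique _).trans ?_)
  congr 1
  exact (Config.init_next_stationary _ _ _).trans
    (Config.embed_init (Q := fun b => (M b).Q) (fun b => (M b).blank) b _).symm

/-- Sums over the register symbols of `choice M`. -/
lemma sum_choice_R {E : Type*} [AddCommMonoid E] (F : (choice M).R → E) :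
    ∑ ω, F ω = ∑ b, ∑ i, F (tossReg M b i) + ∑ b, ∑ ω, F (simReg M b ω) := by
  refine (Fintype.sum_sum_type (α₁ := Bool × Bool) (α₂ := Σ b, (M b).R) F).trans ?_
  rw [Fintype.sum_prod_type, Fintype.sum_sigma]
  rfl

lemma gram_choice_embed (w : List A) (b : Bool) (c c' : Config (M b).Q (M b).G) :
    (choice M).gram w (embed M b c) (embed M b c') = (M b).gram w c c' := by
  rw [gram, sum_choice_R]
  simp only [column_choice_embed_toss, Finsupp.sum_zero_index, Finset.sum_const_zero, zero_add]
  rw [Fintype.sum_eq_single b]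
  · refine Finset.sum_congr rfl fun ω _ => ?_
    rw [column_choice_embed_sim, column_choice_embed_sim,
      Finsupp.sum_mapDomain_index_inj (embed_injective M b)]
    simp only [Finsupp.mapDomain_apply (embed_injective M b)]
  · intro b' hb'
    simp [column_choice_embed_sim_ne M w hb']

/-- The register symbol records which machine is simulated, so for each symbol at least one of the
two columns is zero. -/
lemma gram_choice_embed_ne (w : List A) {b b' : Bool} (h : b ≠ b') (c : Config (M b).Q (M b).G)
    (c' : Config (M b').Q (M b').G) :
    (choice M).gram w (embed M b c) (embed M b' c') = 0 := by
  rw [gram, sum_choice_R]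
  simp only [column_choice_embed_toss, Finsupp.sum_zero_index, Finset.sum_const_zero, zero_add]
  refine Finset.sum_eq_zero fun b'' _ => Finset.sum_eq_zero fun ω _ => ?_
  by_cases h' : b'' = b
  · subst h'
    simp [column_choice_embed_sim_ne M w h]
  · simp [column_choice_embed_sim_ne M w h']

lemma gram_comm (M : QTM A H) (w : List A) (c c' : Config M.Q M.G) :
    M.gram w c c' = M.gram w c' c := by
  classical
  refine Finset.sum_congr rfl fun ω _ => ?_
  rw [Finsupp.sum_of_support_subset _
      (Finset.subset_union_left (s₂ := (M.column w ω c').support)) _ (by simp),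
    Finsupp.sum_of_support_subset _
      (Finset.subset_union_right (s₁ := (M.column w ω c).support)) _ (by simp)]
  exact Finset.sum_congr rfl fun _ _ => mul_comm _ _

lemma gram_choice_init_embed (w : List A) (b : Bool) (c : Config (M b).Q (M b).G) :
    (choice M).gram w (Config.init (choice M).start (choice M).blank) (embed M b c) = 0 := by
  rw [gram, sum_choice_R]
  simp only [column_choice_embed_toss, column_choice_init_sim]
  simp

/-- There are four toss symbols, each contributing `(1/2)² = 1/4`. -/
lemma gram_choice_init (w : List A) :
    (choice M).gram w (Config.init (choice M).start (choice M).blank)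
      (Config.init (choice M).start (choice M).blank) = 1 := by
  rw [gram, sum_choice_R]
  simp only [column_choice_init_toss, column_choice_init_sim]
  simp

/-- The orthonormality conditions concern reachable configurations only, so they have to be checked
just for the initial configuration and for embedded reachable ones. -/
lemma reachable_choice {w : List A} {c : Config (choice M).Q (choice M).G}
    (h : (choice M).Reachable w c) :
    c = Config.init (choice M).start (choice M).blank ∨
      ∃ b c₀, (M b).Reachable w c₀ ∧ c = embed M b c₀ := by
  induction h with
  | init => exact .inl rfl
  | move c c' ω _ hne ih =>
    right
    classical
    rcases ih with rfl | ⟨b, c₀, hc₀, rfl⟩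
    · rcases choice_reg_cases M ω with ⟨b, i, rfl⟩ | ⟨b, ω, rfl⟩
      · rw [column_choice_init_toss, Finsupp.single_apply] at hne
        split_ifs at hne with h
        · exact ⟨b, _, .init, h.symm⟩
        · exact absurd rfl hne
      · rw [column_choice_init_sim] at hne
        exact absurd rfl hne
    · rcases choice_reg_cases M ω with ⟨b', i, rfl⟩ | ⟨b', ω, rfl⟩
      · rw [column_choice_embed_toss] at hne
        exact absurd rfl hne
      · by_cases h : b' = b
        · subst h
          rw [column_choice_embed_sim] at hne
          obtain ⟨c₁, hc₁, rfl⟩ := Finset.mem_image.1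
            (Finsupp.mapDomain_support (Finsupp.mem_support_iff.2 hne))
          exact ⟨b', c₁, .move _ _ ω hc₀ (Finsupp.mem_support_iff.1 hc₁), rfl⟩
        · rw [column_choice_embed_sim_ne M w h] at hne
          exact absurd rfl hne

end Choice

lemma WellFormed.relabel {M : QTM A H} (hM : M.WellFormed) (f : H → H') :
    (M.relabel f).WellFormed := by
  -- Reachability depends on the amplitudes only, which relabelling leaves unchanged.
  have hr : ∀ w c, (M.relabel f).Reachable w c → M.Reachable w c := by
    intro w c h
    induction h with
    | init => exact .init
    | move c c' ω _ h ih => exact .move (M := M) c c' ω ih h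
  exact
  { eff := hM.eff
    gram_self := fun w c h => hM.gram_self w c (hr w c h)
    gram_ne := fun w c c' h h' => hM.gram_ne w c c' (hr w c h) (hr w c' h')
    left_end := hM.left_end
    right_end := hM.right_end
    consistent := fun q σ γ q' d γ' e ω h h' => congrArg (Option.map f)
      (hM.consistent q σ γ q' d γ' e ω (Option.map_eq_none_iff.1 h) h')
    start_continuing := Option.map_eq_none_iff.2 hM.start_continuing
    startReg_continuing := Option.map_eq_none_iff.2 hM.startReg_continuing }

lemma WellFormed.zero_mem {M : QTM A H} (hM : M.WellFormed) : (0 : ℝ) ∈ EffReal := by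
  have h := hM.eff M.start .leftEnd M.blank M.start .left M.blank .left M.startReg
  rwa [hM.left_end] at h

lemma WellFormed.choice {M : Bool → QTM A H} (hM : ∀ b, (M b).WellFormed) :
    (choice M).WellFormed where
  eff q σ γ q' d γ' e ω := choice_δ_induction M q σ γ γ' q' d e ω (hM true).zero_mem
    (fun _ _ _ _ _ _ => half_mem_EffReal) (fun b _ _ _ _ _ _ _ _ => (hM b).eff _ _ _ _ _ _ _ _)
  gram_self w c h := by
    rcases reachable_choice M h with rfl | ⟨b, c, hc, rfl⟩
    · exact gram_choice_init M w
    · rw [gram_choice_embed, (hM b).gram_self w c hc]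
  gram_ne w c c' h h' hne := by
    rcases reachable_choice M h with rfl | ⟨b, c, hc, rfl⟩ <;>
      rcases reachable_choice M h' with rfl | ⟨b', c', hc', rfl⟩
    · exact absurd rfl hne
    · exact gram_choice_init_embed M w b' c'
    · rw [gram_comm, gram_choice_init_embed]
    · by_cases hb : b = b'
      · subst hb
        rw [gram_choice_embed, (hM b).gram_ne w c c' hc hc' fun h => hne (congrArg _ h)]
      · exact gram_choice_embed_ne M w hb c c'
  left_end q γ q' γ' e ω := choice_δ_induction (P := fun x => x = 0) M q .leftEnd γ γ' q' .left e ω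
    rfl (fun _ _ _ h => Dir.noConfusion h)
    (fun b _ _ _ _ _ _ _ _ => (hM b).left_end _ _ _ _ _ _)
  right_end q γ q' γ' e ω := choice_δ_induction (P := fun x => x = 0) M q .rightEnd γ γ' q' .right e
    ω rfl (fun _ _ _ h => Dir.noConfusion h)
    (fun b _ _ _ _ _ _ _ _ => (hM b).right_end _ _ _ _ _ _)
  consistent q σ γ q' d γ' e ω hq := by
    refine choice_δ_induction
      (P := fun x => x ≠ 0 → (QTM.choice M).outcome q' = (QTM.choice M).regOutcome ω)
      M q σ γ γ' q' d e ω (absurd rfl) ?_ ?_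
    · rintro b rfl rfl rfl rfl ⟨i, rfl⟩ -
      exact (hM b).start_continuing
    · rintro b q₀ r ω₀ g g' rfl rfl rfl h
      exact (hM b).consistent _ _ _ _ _ _ _ _ hq h
  start_continuing := rfl
  startReg_continuing := rfl

/-! ### Quadratic homogeneity of the quantum probabilities; consequences of a time bound -/

lemma applyReg_eq_linearCombination (M : QTM A H) (w : List A) (ω : M.R)
    (v : Config M.Q M.G →₀ ℝ) :
    M.applyReg w ω v = Finsupp.linearCombination ℝ (M.column w ω) v := rfl

lemma applyReg_smul (M : QTM A H) (w : List A) (ω : M.R) (a : ℝ) (v : Config M.Q M.G →₀ ℝ) :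
    M.applyReg w ω (a • v) = a • M.applyReg w ω v := by
  simp only [applyReg_eq_linearCombination, map_smul]

lemma normSq_smul (M : QTM A H) (a : ℝ) (v : Config M.Q M.G →₀ ℝ) :
    M.normSq (a • v) = a ^ 2 * M.normSq v := by
  rw [normSq, Finsupp.sum_smul_index (fun _ => by simp), normSq, Finsupp.mul_sum]
  simp only [mul_pow]

lemma normSq_nonneg (M : QTM A H) (v : Config M.Q M.G →₀ ℝ) : 0 ≤ M.normSq v :=
  Finset.sum_nonneg fun _ _ => sq_nonneg _

lemma normSq_eq_zero {M : QTM A H} {v : Config M.Q M.G →₀ ℝ} : M.normSq v = 0 ↔ v = 0 := by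
  refine ⟨fun h => ?_, fun h => by simp [h, normSq]⟩
  rw [normSq, Finsupp.sum, Finset.sum_eq_zero_iff_of_nonneg fun _ _ => sq_nonneg _] at h
  ext c
  by_cases hc : c ∈ v.support
  · exact pow_eq_zero_iff two_ne_zero |>.1 (h c hc)
  · exact Finsupp.notMem_support_iff.1 hc

lemma normSq_single (M : QTM A H) (c : Config M.Q M.G) (a : ℝ) :
    M.normSq (Finsupp.single c a) = a ^ 2 := by
  simp [normSq]

lemma contAt_smul (M : QTM A H) (w : List A) (k : ℕ) (a : ℝ) (v : Config M.Q M.G →₀ ℝ) :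
    M.contAt w k (a • v) = a ^ 2 * M.contAt w k v := by
  induction k generalizing v with
  | zero => exact M.normSq_smul a v
  | succ k ih => simp only [contAt, applyReg_smul, ih, Finset.mul_sum, mul_ite, mul_zero]

lemma contAt_zero_vec (M : QTM A H) (w : List A) (k : ℕ) : M.contAt w k 0 = 0 := by
  simpa using M.contAt_smul w k 0 0

lemma contAt_nonneg (M : QTM A H) (w : List A) (k : ℕ) (v : Config M.Q M.G →₀ ℝ) :
    0 ≤ M.contAt w k v := by
  induction k generalizing v with
  | zero => exact M.normSq_nonneg v
  | succ k ih =>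
    refine Finset.sum_nonneg fun ω _ => ?_
    split_ifs
    exacts [ih _, le_rfl]

lemma contAt_succ_eq_zero_iff (M : QTM A H) (w : List A) (k : ℕ) (v : Config M.Q M.G →₀ ℝ) :
    M.contAt w (k + 1) v = 0 ↔
      ∀ ω, M.regOutcome ω = none → M.contAt w k (M.applyReg w ω v) = 0 := by
  rw [contAt, Finset.sum_eq_zero_iff_of_nonneg]
  · simp
  · intro ω _
    split_ifs
    exacts [M.contAt_nonneg w k _, le_rfl]

/-- If the continuation weight vanishes, every continuing branch is the zero vector and stays zero
by linearity. Preservation of the norm is not involved. -/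
lemma contAt_succ_eq_zero {M : QTM A H} {w : List A} {k : ℕ} {v : Config M.Q M.G →₀ ℝ}
    (h : M.contAt w k v = 0) : M.contAt w (k + 1) v = 0 := by
  induction k generalizing v with
  | zero =>
    rw [normSq_eq_zero.1 h]
    exact M.contAt_zero_vec w 1
  | succ k ih =>
    rw [contAt_succ_eq_zero_iff] at h ⊢
    exact fun ω hω => ih (h ω hω)

lemma contAt_eq_zero_of_le {M : QTM A H} {w : List A} {k l : ℕ} (hkl : k ≤ l)
    {v : Config M.Q M.G →₀ ℝ} (h : M.contAt w k v = 0) : M.contAt w l v = 0 := by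
  induction l, hkl using Nat.le_induction with
  | base => exact h
  | succ l _ ih => exact contAt_succ_eq_zero ih

/-- Before the first move the machine is continuing with weight 1. -/
lemma RunsInTime.pos {M : QTM A H} {T : ℕ → ℕ} (hT : M.RunsInTime T) (w : List A) :
    0 < T w.length := by
  refine Nat.pos_of_ne_zero fun h => ?_
  have h1 := hT w
  rw [h, contAt, initVec, normSq_single] at h1
  norm_num at h1

section HaltAt

variable [DecidableEq H]

lemma haltAt_smul (M : QTM A H) (w : List A) (h : H) (k : ℕ) (a : ℝ)
    (v : Config M.Q M.G →₀ ℝ) :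
    M.haltAt w h k (a • v) = a ^ 2 * M.haltAt w h k v := by
  induction k generalizing v with
  | zero => simp only [haltAt, applyReg_smul, normSq_smul, Finset.mul_sum, mul_ite, mul_zero]
  | succ k ih => simp only [haltAt, applyReg_smul, ih, Finset.mul_sum, mul_ite, mul_zero]

lemma haltAt_zero_vec (M : QTM A H) (w : List A) (h : H) (k : ℕ) : M.haltAt w h k 0 = 0 := by
  simpa using M.haltAt_smul w h k 0 0

lemma haltAt_nonneg (M : QTM A H) (w : List A) (h : H) (k : ℕ) (v : Config M.Q M.G →₀ ℝ) :
    0 ≤ M.haltAt w h k v := by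
  induction k generalizing v with
  | zero =>
    refine Finset.sum_nonneg fun ω _ => ?_
    split_ifs
    exacts [M.normSq_nonneg _, le_rfl]
  | succ k ih =>
    refine Finset.sum_nonneg fun ω _ => ?_
    split_ifs
    exacts [ih _, le_rfl]

lemma haltProb_nonneg (M : QTM A H) (h : H) (w : List A) : 0 ≤ M.haltProb h w :=
  tsum_nonneg fun k => M.haltAt_nonneg w h k _

lemma haltAt_eq_zero {M : QTM A H} {w : List A} {k : ℕ} {v : Config M.Q M.G →₀ ℝ} (h : H)
    (hv : M.contAt w k v = 0) : M.haltAt w h k v = 0 := by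
  induction k generalizing v with
  | zero =>
    rw [normSq_eq_zero.1 hv]
    exact M.haltAt_zero_vec w h 0
  | succ k ih =>
    rw [contAt_succ_eq_zero_iff] at hv
    refine Finset.sum_eq_zero fun ω _ => ?_
    split_ifs with hω
    exacts [ih (hv ω hω), rfl]

lemma RunsInTime.summable {M : QTM A H} {T : ℕ → ℕ} (hT : M.RunsInTime T) (h : H) (w : List A) :
    Summable fun k => M.haltAt w h k M.initVec := by
  -- Index `k` stands for halting in move `k + 1`, so already the term of index `T w.length` is
  -- zero.
  refine summable_of_ne_finset_zero (s := Finset.range (T w.length)) fun k hk => ?_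
  rw [Finset.mem_range, not_lt] at hk
  exact haltAt_eq_zero h (contAt_eq_zero_of_le hk (hT w))

end HaltAt

section Relabel

variable (M : QTM A H) (f : H → H')

lemma contAt_relabel (w : List A) (k : ℕ) (v : Config M.Q M.G →₀ ℝ) :
    (M.relabel f).contAt w k v = M.contAt w k v := by
  induction k generalizing v with
  | zero => rfl
  | succ k ih =>
    refine Finset.sum_congr rfl fun ω _ => ?_
    simp only [relabel, Option.map_eq_none_iff]
    exact if_congr Iff.rfl (ih _) rfl

lemma RunsInTime.relabel {M : QTM A H} {T : ℕ → ℕ} (hT : M.RunsInTime T) (f : H → H') :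
    (M.relabel f).RunsInTime T := fun w => (M.contAt_relabel f w _ _).trans (hT w)

lemma haltAt_relabel [DecidableEq H] [DecidableEq H'] {h : H} (hf : ∀ x, f x = f h → x = h)
    (w : List A) (k : ℕ) (v : Config M.Q M.G →₀ ℝ) :
    (M.relabel f).haltAt w (f h) k v = M.haltAt w h k v := by
  induction k generalizing v with
  | zero =>
    refine Finset.sum_congr rfl fun ω _ => if_congr ?_ rfl rfl
    simp only [relabel, Option.map_eq_some_iff]
    exact ⟨fun ⟨x, hx, hx'⟩ => hf x hx' ▸ hx, fun hx => ⟨h, hx, rfl⟩⟩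
  | succ k ih =>
    exact Finset.sum_congr rfl fun ω _ => if_congr Option.map_eq_none_iff (ih _) rfl

lemma haltProb_relabel [DecidableEq H] [DecidableEq H'] {h : H} (hf : ∀ x, f x = f h → x = h)
    (w : List A) : (M.relabel f).haltProb (f h) w = M.haltProb h w :=
  tsum_congr fun k => M.haltAt_relabel f hf w k _

lemma haltAt_relabel_eq_zero [DecidableEq H'] {h' : H'} (hf : ∀ x, f x ≠ h') (w : List A) (k : ℕ)
    (v : Config M.Q M.G →₀ ℝ) : (M.relabel f).haltAt w h' k v = 0 := by
  induction k generalizing v with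
  | zero => exact Finset.sum_eq_zero fun ω _ => if_neg (by simp [relabel, hf])
  | succ k ih =>
    refine Finset.sum_eq_zero fun ω _ => ?_
    split_ifs
    exacts [ih _, rfl]

lemma haltProb_relabel_eq_zero [DecidableEq H'] {h' : H'} (hf : ∀ x, f x ≠ h') (w : List A) :
    (M.relabel f).haltProb h' w = 0 :=
  (tsum_congr fun k => M.haltAt_relabel_eq_zero f hf w k _).trans tsum_zero

end Relabel

/-! ### Halting probabilities of the quantum choice -/

section Choice

variable (M : Bool → QTM A H)

lemma applyReg_choice_toss (w : List A) (b' i b : Bool)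
    (v : Config (M b).Q (M b).G →₀ ℝ) :
    (choice M).applyReg w (tossReg M b' i) (v.mapDomain (embed M b)) = 0 := by
  rw [applyReg_eq_linearCombination, Finsupp.linearCombination_mapDomain,
    Finsupp.linearCombination_apply]
  exact Finset.sum_eq_zero fun c _ => by
    dsimp only [Function.comp_apply]
    rw [column_choice_embed_toss, smul_zero]

lemma applyReg_choice_sim_ne (w : List A) {b b' : Bool} (h : b' ≠ b) (ω : (M b').R)
    (v : Config (M b).Q (M b).G →₀ ℝ) :
    (choice M).applyReg w (simReg M b' ω) (v.mapDomain (embed M b)) = 0 := by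
  rw [applyReg_eq_linearCombination, Finsupp.linearCombination_mapDomain,
    Finsupp.linearCombination_apply]
  exact Finset.sum_eq_zero fun c _ => by
    dsimp only [Function.comp_apply]
    rw [column_choice_embed_sim_ne M w h, smul_zero]

lemma applyReg_choice_sim (w : List A) (b : Bool) (ω : (M b).R)
    (v : Config (M b).Q (M b).G →₀ ℝ) :
    (choice M).applyReg w (simReg M b ω) (v.mapDomain (embed M b)) =
      ((M b).applyReg w ω v).mapDomain (embed M b) := by
  rw [applyReg_eq_linearCombination, applyReg_eq_linearCombination,
    Finsupp.linearCombination_mapDomain, ← Finsupp.lmapDomain_apply ℝ ℝ,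
    Finsupp.apply_linearCombination]
  congr 2
  funext c
  exact column_choice_embed_sim M w b ω c

lemma applyReg_choice_initVec_toss (w : List A) (b i : Bool) :
    (choice M).applyReg w (tossReg M b i) (choice M).initVec =
      (1 / 2 : ℝ) • (M b).initVec.mapDomain (embed M b) := by
  rw [applyReg_eq_linearCombination, initVec, initVec, Finsupp.linearCombination_single, one_smul,
    Finsupp.mapDomain_single, Finsupp.smul_single, smul_eq_mul, mul_one]
  exact column_choice_init_toss M w b i

lemma applyReg_choice_initVec_sim (w : List A) (b : Bool) (ω : (M b).R) :
    (choice M).applyReg w (simReg M b ω) (choice M).initVec = 0 := by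
  rw [applyReg_eq_linearCombination, initVec, Finsupp.linearCombination_single, one_smul]
  exact column_choice_init_sim M w b ω

/-- The common induction step for `contAt` and `haltAt`: `F` is the quantity evaluated on the rest
of the run, and `P` selects the observed outcome. Symbols of the toss and of the other machine give
the zero vector. -/
lemma sum_applyReg_choice_mapDomain {P : Option H → Prop} [DecidablePred P]
    {F : (Config (choice M).Q (choice M).G →₀ ℝ) → ℝ} (hF : F 0 = 0) (w : List A) (b : Bool)
    (v : Config (M b).Q (M b).G →₀ ℝ) :
    (∑ ω, if P ((choice M).regOutcome ω) then
        F ((choice M).applyReg w ω (v.mapDomain (embed M b))) else 0) =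
      ∑ ω, if P ((M b).regOutcome ω) then
        F (((M b).applyReg w ω v).mapDomain (embed M b)) else 0 := by
  rw [sum_choice_R]
  simp only [applyReg_choice_toss, hF, ite_self, Finset.sum_const_zero, zero_add]
  rw [Fintype.sum_eq_single b]
  · simp only [applyReg_choice_sim]
    rfl
  · intro b' hb'
    simp [applyReg_choice_sim_ne M w hb', hF]

/-- Each machine is entered under two register symbols, and the quadratic `F` turns the amplitude `1
/ 2` into weight `1 / 4` for each. -/
lemma sum_applyReg_choice_initVec {F : (Config (choice M).Q (choice M).G →₀ ℝ) → ℝ}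
    (hF : F 0 = 0) (hF' : ∀ v, F ((1 / 2 : ℝ) • v) = (1 / 2) ^ 2 * F v) (w : List A) :
    (∑ ω, if (choice M).regOutcome ω = none then
        F ((choice M).applyReg w ω (choice M).initVec) else 0) =
      ∑ b, F ((M b).initVec.mapDomain (embed M b)) / 2 := by
  rw [sum_choice_R]
  simp only [applyReg_choice_initVec_toss, applyReg_choice_initVec_sim, hF, hF', ite_self,
    Finset.sum_const_zero, add_zero]
  refine Finset.sum_congr rfl fun b _ => ?_
  refine (Fintype.sum_bool _).trans ?_
  rw [if_pos (show (choice M).regOutcome (tossReg M b true) = none from rfl),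
    if_pos (show (choice M).regOutcome (tossReg M b false) = none from rfl)]
  ring

lemma normSq_choice_mapDomain (b : Bool) (v : Config (M b).Q (M b).G →₀ ℝ) :
    (choice M).normSq (v.mapDomain (embed M b)) = (M b).normSq v :=
  Finsupp.sum_mapDomain_index_inj (embed_injective M b)

lemma contAt_choice_mapDomain (w : List A) (k : ℕ) (b : Bool) (v : Config (M b).Q (M b).G →₀ ℝ) :
    (choice M).contAt w k (v.mapDomain (embed M b)) = (M b).contAt w k v := by
  induction k generalizing v with
  | zero => exact normSq_choice_mapDomain M b v
  | succ k ih =>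
    refine (sum_applyReg_choice_mapDomain M (P := fun o => o = none)
      ((choice M).contAt_zero_vec w k) w b v).trans ?_
    simp only [ih]
    rfl

lemma contAt_choice_initVec (w : List A) (k : ℕ) :
    (choice M).contAt w (k + 1) (choice M).initVec = ∑ b, (M b).contAt w k (M b).initVec / 2 := by
  refine (sum_applyReg_choice_initVec M ((choice M).contAt_zero_vec w k)
    ((choice M).contAt_smul w k _) w).trans ?_
  simp only [contAt_choice_mapDomain]

lemma haltAt_choice_mapDomain [DecidableEq H] (w : List A) (h : H) (k : ℕ) (b : Bool)
    (v : Config (M b).Q (M b).G →₀ ℝ) :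
    (choice M).haltAt w h k (v.mapDomain (embed M b)) = (M b).haltAt w h k v := by
  induction k generalizing v with
  | zero =>
    refine (sum_applyReg_choice_mapDomain M (P := fun o => o = some h)
      (normSq_eq_zero.2 rfl) w b v).trans ?_
    simp only [normSq_choice_mapDomain]
    rfl
  | succ k ih =>
    refine (sum_applyReg_choice_mapDomain M (P := fun o => o = none)
      ((choice M).haltAt_zero_vec w h k) w b v).trans ?_
    simp only [ih]
    rfl

lemma haltAt_choice_initVec_zero [DecidableEq H] (w : List A) (h : H) :
    (choice M).haltAt w h 0 (choice M).initVec = 0 := by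
  rw [haltAt, sum_choice_R]
  simp only [applyReg_choice_initVec_sim, normSq_eq_zero.2, ite_self, Finset.sum_const_zero,
    add_zero]
  exact Finset.sum_eq_zero fun b _ => Finset.sum_eq_zero fun i _ =>
    if_neg fun h' => Option.some_ne_none h h'.symm

lemma haltAt_choice_initVec_succ [DecidableEq H] (w : List A) (h : H) (k : ℕ) :
    (choice M).haltAt w h (k + 1) (choice M).initVec =
      ∑ b, (M b).haltAt w h k (M b).initVec / 2 := by
  refine (sum_applyReg_choice_initVec M ((choice M).haltAt_zero_vec w h k)
    ((choice M).haltAt_smul w h k _) w).trans ?_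
  simp only [haltAt_choice_mapDomain]

variable {M}

lemma RunsInTime.choice {T : Bool → ℕ → ℕ} (hT : ∀ b, (M b).RunsInTime (T b)) :
    (choice M).RunsInTime fun n => T true n + T false n := by
  intro w
  have h1 := (hT true).pos w
  have h2 := (hT false).pos w
  obtain ⟨k, hk⟩ : ∃ k, T true w.length + T false w.length = k + 1 :=
    ⟨T true w.length + T false w.length - 1, by omega⟩
  change (QTM.choice M).contAt w (T true w.length + T false w.length) _ = 0
  rw [hk, contAt_choice_initVec]
  refine Finset.sum_eq_zero fun b _ => ?_
  rw [contAt_eq_zero_of_le (by cases b <;> omega) (hT b w), zero_div]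

lemma haltProb_choice [DecidableEq H] {T : Bool → ℕ → ℕ} (hT : ∀ b, (M b).RunsInTime (T b))
    (h : H) (w : List A) :
    (choice M).haltProb h w = ((M true).haltProb h w + (M false).haltProb h w) / 2 := by
  have hs : ∀ k, (choice M).haltAt w h (k + 1) (choice M).initVec =
      (M true).haltAt w h k (M true).initVec / 2 +
        (M false).haltAt w h k (M false).initVec / 2 := fun k => by
    rw [haltAt_choice_initVec_succ, Fintype.sum_bool]
  have hsum := ((hT true).summable h w).div_const 2
  have hsum' := ((hT false).summable h w).div_const 2
  rw [haltProb, haltProb, haltProb,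
    ((summable_nat_add_iff 1).1 ((hsum.add hsum').congr fun k => (hs k).symm)).tsum_eq_zero_add,
    haltAt_choice_initVec_zero, zero_add, tsum_congr hs, hsum.tsum_add hsum', tsum_div_const,
    tsum_div_const, add_div]

end Choice

end QTM

/-! ### Real-time probabilistic finite automata and regular languages -/

namespace PFA

variable {A : Type*} {H : Type} (M : PFA A H)

/-- The states reached with positive probability from the states in `S` on reading `σ`. -/
def next (σ : InSym A) (S : Set M.Q) : Set M.Q := {j | ∃ i ∈ S, 0 < M.mat σ j i}

lemma mulVec_nonneg (σ : InSym A) {v : M.Q → ℝ} (hv : 0 ≤ v) : 0 ≤ M.mat σ *ᵥ v :=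
  fun j => Finset.sum_nonneg fun i _ => mul_nonneg (M.nonneg σ j i) (hv i)

lemma foldl_nonneg (l : List (InSym A)) {v : M.Q → ℝ} (hv : 0 ≤ v) :
    0 ≤ l.foldl (fun v σ => M.mat σ *ᵥ v) v := by
  induction l generalizing v with
  | nil => exact hv
  | cons σ l ih => exact ih (M.mulVec_nonneg σ hv)

/-- Nonnegative terms cannot cancel, so the support of the new vector depends on the support of the
old one alone. -/
lemma setOf_mulVec_pos (σ : InSym A) {v : M.Q → ℝ} (hv : 0 ≤ v) :
    {j | 0 < (M.mat σ *ᵥ v) j} = M.next σ {i | 0 < v i} := by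
  ext j
  simp only [next, Set.mem_ofPred_eq, Matrix.mulVec, dotProduct]
  rw [Finset.sum_pos_iff_of_nonneg fun i _ => mul_nonneg (M.nonneg σ j i) (hv i)]
  refine exists_congr fun i => ⟨fun ⟨_, h⟩ => ?_, fun ⟨h, h'⟩ => ⟨Finset.mem_univ i, mul_pos h' h⟩⟩
  exact ⟨pos_of_mul_pos_right h (M.nonneg σ j i), pos_of_mul_pos_left h (hv i)⟩

lemma setOf_foldl_pos (l : List (InSym A)) {v : M.Q → ℝ} (hv : 0 ≤ v) :
    {j | 0 < l.foldl (fun v σ => M.mat σ *ᵥ v) v j} =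
      l.foldl (fun S σ => M.next σ S) {i | 0 < v i} := by
  induction l generalizing v with
  | nil => rfl
  | cons σ l ih =>
    rw [List.foldl_cons, List.foldl_cons, ih (M.mulVec_nonneg σ hv), setOf_mulVec_pos M σ hv]

lemma isRegular_setOf_haltProb_pos [DecidableEq H] (h : H) :
    Language.IsRegular ({w | 0 < M.haltProb h w} : Language A) := by
  -- The deterministic automaton reads no end-markers: the left one is absorbed into the start
  -- state, the right one into the acceptance condition.
  let D : DFA A (Set M.Q) :=
    { step := fun S a => M.next (.letter a) S
      start := M.next .leftEnd {i | 0 < (Pi.single M.start 1 : M.Q → ℝ) i}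
      accept := {S | ∃ q ∈ M.next .rightEnd S, M.outcome q = h} }
  refine ⟨Set M.Q, inferInstance, D, ?_⟩
  have h0 : (0 : M.Q → ℝ) ≤ Pi.single M.start 1 := Pi.single_nonneg.2 zero_le_one
  ext w
  have key : {j | 0 < M.finalVec w j} = M.next .rightEnd (D.eval w) := by
    rw [finalVec, setOf_foldl_pos M _ h0, endMarked, List.foldl_cons, List.foldl_append,
      List.foldl_map]
    rfl
  rw [DFA.mem_accepts]
  change (∃ q ∈ M.next .rightEnd (D.eval w), M.outcome q = h) ↔ 0 < M.haltProb h w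
  rw [← key, haltProb, Finset.sum_pos_iff_of_nonneg]
  · refine exists_congr fun q => ⟨fun ⟨hq, hq'⟩ => ?_, fun ⟨_, hq⟩ => ?_⟩
    · exact ⟨Finset.mem_univ q, by rwa [if_pos hq']⟩
    · split_ifs at hq with hq'
      · exact ⟨hq, hq'⟩
      · exact absurd hq (lt_irrefl 0)
  · intro q _
    split_ifs
    exacts [M.foldl_nonneg _ h0 q, le_rfl]

lemma finalVec_of_deterministic {move : InSym A → M.Q → M.Q}
    (hM : ∀ σ j i, M.mat σ j i = if j = move σ i then 1 else 0) (w : List A) :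
    M.finalVec w = Pi.single ((endMarked w).foldl (fun q σ => move σ q) M.start) 1 := by
  have hfold : ∀ (l : List (InSym A)) (q : M.Q),
      l.foldl (fun v σ => M.mat σ *ᵥ v) (Pi.single q 1) =
        Pi.single (l.foldl (fun q σ => move σ q) q) 1 := by
    intro l
    induction l with
    | nil => exact fun _ => rfl
    | cons σ l ih =>
      intro q
      rw [List.foldl_cons, List.foldl_cons, ← ih, Matrix.mulVec_single_one]
      congr 1
      funext j
      rw [Matrix.col_apply, hM, Pi.single_apply]
  exact hfold _ _

lemma haltProb_of_deterministic [DecidableEq H] {move : InSym A → M.Q → M.Q}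
    (hM : ∀ σ j i, M.mat σ j i = if j = move σ i then 1 else 0) (h : H) (w : List A) :
    M.haltProb h w =
      if M.outcome ((endMarked w).foldl (fun q σ => move σ q) M.start) = h then 1 else 0 := by
  rw [haltProb, finalVec_of_deterministic M hM]
  rw [Fintype.sum_eq_single ((endMarked w).foldl (fun q σ => move σ q) M.start), Pi.single_eq_same]
  intro q hq
  rw [Pi.single_eq_of_ne hq, ite_self]

/-- The move of a deterministic automaton that ignores the end-markers. -/
def dfaMove {S : Type} (D : DFA A S) : InSym A → S → S
  | .letter a, q => D.step q a
  | _, q => q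

open Classical in
/-- A deterministic automaton as a probabilistic automaton with postselection. -/
noncomputable def ofDFA {S : Type} [Fintype S] (D : DFA A S) : PFA A Post where
  Q := S
  start := D.start
  mat σ := Matrix.of fun j i => if j = dfaMove D σ i then 1 else 0
  outcome q := if q ∈ D.accept then .accept else .reject
  nonneg σ j i := by
    rw [Matrix.of_apply]
    split_ifs
    exacts [zero_le_one, le_rfl]
  sum_eq_one σ i := by simp

open Classical in
lemma haltProb_ofDFA {S : Type} [Fintype S] (D : DFA A S) (h : Post) (w : List A) :
    (ofDFA D).haltProb h w =
      if (if D.eval w ∈ D.accept then Post.accept else Post.reject) = h then 1 else 0 := by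
  rw [haltProb_of_deterministic (ofDFA D) (move := dfaMove D) (fun _ _ _ => rfl), endMarked,
    List.foldl_cons, List.foldl_append, List.foldl_map]
  rfl

end PFA

/-! ### Real-time quantum finite automata -/

namespace QFA

open scoped Kronecker

variable {A : Type*} {H H' : Type}

/-- Apply `f` to the outcomes. -/
def relabel (f : H → H') (M : QFA A H) : QFA A H' where
  Q := M.Q
  finQ := M.finQ
  decQ := M.decQ
  start := M.start
  num := M.num
  kraus := M.kraus
  outcome q := f (M.outcome q)
  complete := M.complete

lemma haltProb_eq_sum [DecidableEq H] (M : QFA A H) (h : H) (w : List A) :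
    M.haltProb h w = ∑ q, if M.outcome q = h then M.finalDensity w q q else 0 := by
  simp [haltProb, proj, Matrix.trace, Matrix.diagonal_mul]

lemma haltProb_relabel [DecidableEq H] [DecidableEq H'] (M : QFA A H) {f : H → H'} {h : H}
    (hf : ∀ x, f x = f h → x = h) (w : List A) :
    (M.relabel f).haltProb (f h) w = M.haltProb h w := by
  rw [haltProb_eq_sum, haltProb_eq_sum]
  exact Finset.sum_congr rfl fun q _ => if_congr ⟨hf _, congrArg f⟩ rfl rfl

lemma posSemidef_foldl (M : QFA A H) (l : List (InSym A)) {ρ : Matrix M.Q M.Q ℝ}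
    (hρ : ρ.PosSemidef) :
    (l.foldl (fun ρ σ => ∑ i, M.kraus σ i * ρ * (M.kraus σ i)ᵀ) ρ).PosSemidef := by
  induction l generalizing ρ with
  | nil => exact hρ
  | cons σ l ih =>
    refine ih (Matrix.posSemidef_sum _ fun i _ => ?_)
    simpa using hρ.mul_mul_conjTranspose_same (M.kraus σ i)

/-- Cyclicity of the trace brings the operation elements together as `∑ i, (kraus σ i)ᵀ * kraus σ
i`, which is the identity. -/
lemma trace_foldl (M : QFA A H) (l : List (InSym A)) (ρ : Matrix M.Q M.Q ℝ) :
    (l.foldl (fun ρ σ => ∑ i, M.kraus σ i * ρ * (M.kraus σ i)ᵀ) ρ).trace = ρ.trace := by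
  induction l generalizing ρ with
  | nil => rfl
  | cons σ l ih =>
    rw [List.foldl_cons, ih, Matrix.trace_sum]
    simp_rw [Matrix.trace_mul_cycle (M.kraus σ _) ρ]
    rw [← Matrix.trace_sum, ← Finset.sum_mul, M.complete, one_mul]

lemma posSemidef_finalDensity (M : QFA A H) (w : List A) : (M.finalDensity w).PosSemidef := by
  refine M.posSemidef_foldl _ ?_
  rw [← Matrix.diagonal_single]
  exact Matrix.PosSemidef.diagonal (Pi.single_nonneg.2 zero_le_one)

lemma trace_finalDensity (M : QFA A H) (w : List A) : (M.finalDensity w).trace = 1 := by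
  rw [finalDensity, trace_foldl, Matrix.trace_single_eq_same]

lemma haltProb_nonneg [DecidableEq H] (M : QFA A H) (h : H) (w : List A) :
    0 ≤ M.haltProb h w := by
  rw [haltProb_eq_sum]
  refine Finset.sum_nonneg fun q _ => ?_
  split_ifs
  exacts [(M.posSemidef_finalDensity w).diag_nonneg, le_rfl]

/-- Needed to turn acceptance with probability 0 into rejection with probability 1. -/
lemma haltProb_accept_add_reject (M : QFA A Std) (w : List A) :
    M.haltProb .accept w + M.haltProb .reject w = 1 := by
  rw [haltProb_eq_sum, haltProb_eq_sum, ← Finset.sum_add_distrib, ← M.trace_finalDensity w]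
  refine Finset.sum_congr rfl fun q _ => ?_
  cases M.outcome q <;> simp

lemma sum_kronecker_sum {ι κ m n : Type*} [Fintype ι] [Fintype κ] (f : ι → Matrix m m ℝ)
    (g : κ → Matrix n n ℝ) : (∑ i, f i) ⊗ₖ (∑ j, g j) = ∑ x : ι × κ, f x.1 ⊗ₖ g x.2 := by
  ext ⟨a, b⟩ ⟨c, d⟩
  simp [Matrix.kroneckerMap_apply, Matrix.sum_apply, Finset.sum_mul_sum, Fintype.sum_prod_type]

/-- The automaton that runs two automata in parallel; its outcome is a function of the two
outcomes. -/
def prod {H₁ H₂ : Type} (f : H₁ → H₂ → H) (M₁ : QFA A H₁) (M₂ : QFA A H₂) : QFA A H where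
  Q := M₁.Q × M₂.Q
  start := (M₁.start, M₂.start)
  num σ := M₁.num σ * M₂.num σ
  kraus σ i := M₁.kraus σ (finProdFinEquiv.symm i).1 ⊗ₖ M₂.kraus σ (finProdFinEquiv.symm i).2
  outcome q := f (M₁.outcome q.1) (M₂.outcome q.2)
  complete σ := by
    rw [Equiv.sum_comp finProdFinEquiv.symm (fun x =>
      (M₁.kraus σ x.1 ⊗ₖ M₂.kraus σ x.2)ᵀ * (M₁.kraus σ x.1 ⊗ₖ M₂.kraus σ x.2))]
    simp_rw [← Matrix.kroneckerMap_transpose, ← Matrix.mul_kronecker_mul]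
    rw [← sum_kronecker_sum (fun i => (M₁.kraus σ i)ᵀ * M₁.kraus σ i)
      (fun i => (M₂.kraus σ i)ᵀ * M₂.kraus σ i), M₁.complete, M₂.complete,
      Matrix.one_kronecker_one]

/-- By the mixed-product rule the joint superoperator is the tensor product of the two, so a product
state remains a product state. -/
lemma finalDensity_prod {H₁ H₂ : Type} (f : H₁ → H₂ → H) (M₁ : QFA A H₁) (M₂ : QFA A H₂)
    (w : List A) :
    (prod f M₁ M₂).finalDensity w = M₁.finalDensity w ⊗ₖ M₂.finalDensity w := by
  have hfold : ∀ (l : List (InSym A)) (ρ₁ : Matrix M₁.Q M₁.Q ℝ) (ρ₂ : Matrix M₂.Q M₂.Q ℝ),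
      l.foldl (fun (ρ : Matrix (prod f M₁ M₂).Q (prod f M₁ M₂).Q ℝ) σ =>
          ∑ i, (prod f M₁ M₂).kraus σ i * ρ * ((prod f M₁ M₂).kraus σ i)ᵀ)
        (ρ₁ ⊗ₖ ρ₂) =
      l.foldl (fun ρ σ => ∑ i, M₁.kraus σ i * ρ * (M₁.kraus σ i)ᵀ) ρ₁ ⊗ₖ
        l.foldl (fun ρ σ => ∑ i, M₂.kraus σ i * ρ * (M₂.kraus σ i)ᵀ) ρ₂ := by
    intro l
    induction l with
    | nil => exact fun _ _ => rfl
    | cons σ l ih =>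
      intro ρ₁ ρ₂
      refine (congrArg (fun ρ => List.foldl _ ρ l) ?_).trans (ih _ _)
      rw [sum_kronecker_sum]
      refine (Equiv.sum_comp finProdFinEquiv.symm (fun x =>
        (M₁.kraus σ x.1 ⊗ₖ M₂.kraus σ x.2) * (ρ₁ ⊗ₖ ρ₂) *
          (M₁.kraus σ x.1 ⊗ₖ M₂.kraus σ x.2)ᵀ)).trans ?_
      simp_rw [← Matrix.kroneckerMap_transpose, ← Matrix.mul_kronecker_mul]
  rw [finalDensity, finalDensity, finalDensity, ← hfold]
  congr 1
  refine Eq.trans ?_ (Matrix.single_kronecker_single _ _ _ _ _ _).symm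
  rw [one_mul]
  rfl

lemma haltProb_prod {H₁ H₂ : Type} [DecidableEq H] [DecidableEq H₁] [DecidableEq H₂]
    {f : H₁ → H₂ → H} (M₁ : QFA A H₁) (M₂ : QFA A H₂) {h₁ : H₁} {h₂ : H₂} {h : H}
    (hf : ∀ x y, f x y = h ↔ x = h₁ ∧ y = h₂) (w : List A) :
    (prod f M₁ M₂).haltProb h w = M₁.haltProb h₁ w * M₂.haltProb h₂ w := by
  rw [haltProb_eq_sum, haltProb_eq_sum, haltProb_eq_sum, finalDensity_prod, Finset.sum_mul_sum]
  refine (Fintype.sum_prod_type _).trans ?_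
  refine Finset.sum_congr rfl fun q₁ _ => Finset.sum_congr rfl fun q₂ _ => ?_
  refine (if_congr (hf (M₁.outcome q₁) (M₂.outcome q₂)) rfl rfl).trans ?_
  rw [ite_and]
  split_ifs <;> simp [Matrix.kroneckerMap_apply]

end QFA

/-! ### Error-free postselection and nondeterministic recognition -/

section Recognition

variable {A : Type*} {p : Post → List A → ℝ} {L : Language A}

/-- A ratio of at least 1 says that `p .accept w + p .reject w` is at most its numerator. The
positive denominator makes that numerator positive, and the other summand is at most 0. -/
lemma PostErrorFreeRecognizes.mem_iff (h : PostErrorFreeRecognizes p L) (w : List A) :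
    w ∈ L ↔ 0 < p .accept w := by
  obtain ⟨h0, h1, h2⟩ := h
  refine ⟨fun hw => ?_, fun hw => by_contra fun hw' => ?_⟩
  · have := h1 w hw
    rw [sub_zero, postAccProb, one_le_div (h0 w)] at this
    linarith [h0 w]
  · have := h2 w hw'
    rw [sub_zero, postRejProb, one_le_div (h0 w)] at this
    linarith

lemma PostErrorFreeRecognizes.mem_compl_iff (h : PostErrorFreeRecognizes p L) (w : List A) :
    w ∈ Lᶜ ↔ 0 < p .reject w := by
  obtain ⟨h0, h1, h2⟩ := h
  refine ⟨fun hw => ?_, fun hw hw' => ?_⟩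
  · have := h2 w hw
    rw [sub_zero, postRejProb, one_le_div (h0 w)] at this
    linarith [h0 w]
  · have := h1 w hw'
    rw [sub_zero, postAccProb, one_le_div (h0 w)] at this
    linarith

lemma postErrorFreeRecognizes_of_pos (h1 : ∀ w ∈ L, 0 < p .accept w ∧ p .reject w = 0)
    (h2 : ∀ w ∉ L, p .accept w = 0 ∧ 0 < p .reject w) : PostErrorFreeRecognizes p L := by
  refine ⟨fun w => ?_, fun w hw => ?_, fun w hw => ?_⟩
  · by_cases hw : w ∈ L
    · linarith [h1 w hw]
    · linarith [h2 w hw]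
  · obtain ⟨ha, hr⟩ := h1 w hw
    rw [postAccProb, hr, add_zero, div_self ha.ne', sub_zero]
  · obtain ⟨ha, hr⟩ := h2 w hw
    rw [postRejProb, ha, zero_add, div_self hr.ne', sub_zero]

lemma NondetRecognizes.eq_zero {q : Std → List A → ℝ} (h : NondetRecognizes q L) {w : List A}
    (hq : 0 ≤ q .accept w) (hw : w ∉ L) : q .accept w = 0 :=
  le_antisymm (not_lt.1 fun h' => hw ((h w).2 h')) hq

/-- Recognition of a language and of its complement combine to error-free postselection. -/
lemma postErrorFreeRecognizes_of_nondet {q₁ q₂ : Std → List A → ℝ} (h₁ : NondetRecognizes q₁ L)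
    (h₂ : NondetRecognizes q₂ Lᶜ) (n₁ : ∀ w, 0 ≤ q₁ .accept w) (n₂ : ∀ w, 0 ≤ q₂ .accept w)
    (ha : ∀ w, p .accept w = q₁ .accept w / 2) (hr : ∀ w, p .reject w = q₂ .accept w / 2) :
    PostErrorFreeRecognizes p L := by
  refine postErrorFreeRecognizes_of_pos (fun w hw => ?_) fun w hw => ?_
  · rw [ha, hr, h₂.eq_zero (n₂ w) (fun h => h hw), zero_div]
    exact ⟨half_pos ((h₁ w).1 hw), rfl⟩
  · rw [ha, hr, h₁.eq_zero (n₁ w) hw, zero_div]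
    exact ⟨rfl, half_pos ((h₂ w).1 hw)⟩

/-- Postselection acceptance as the only acceptance. -/
def Post.acceptOnly : Post → Std
  | .accept => .accept
  | _ => .reject

/-- Postselection rejection as the only acceptance. -/
def Post.rejectOnly : Post → Std
  | .reject => .accept
  | _ => .reject

/-- Acceptance becomes postselection acceptance if `b`, postselection rejection otherwise;
rejection becomes nonpostselection halting. -/
def Std.toPost (b : Bool) : Std → Post
  | .accept => if b then .accept else .reject
  | .reject => .nonpost

lemma Post.eq_accept_of_acceptOnly (x : Post) (h : x.acceptOnly = Post.accept.acceptOnly) :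
    x = .accept := by
  cases x <;> simp_all [acceptOnly]

lemma Post.eq_reject_of_rejectOnly (x : Post) (h : x.rejectOnly = Post.reject.rejectOnly) :
    x = .reject := by
  cases x <;> simp_all [rejectOnly]

lemma Std.eq_accept_of_toPost (b : Bool) (x : Std) (h : x.toPost b = Std.accept.toPost b) :
    x = .accept := by
  cases b <;> cases x <;> simp_all [toPost]

lemma Std.toPost_true_ne_reject (x : Std) : x.toPost true ≠ .reject := by
  cases x <;> simp [toPost]

lemma Std.toPost_false_ne_accept (x : Std) : x.toPost false ≠ .accept := by
  cases x <;> simp [toPost]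

/-- Two outcomes decide the postselected outcome when exactly one of the machines accepts. -/
def Std.combine : Std → Std → Post
  | .accept, .reject => .accept
  | .reject, .accept => .reject
  | _, _ => .nonpost

lemma Std.combine_eq_accept (x y : Std) : x.combine y = .accept ↔ x = .accept ∧ y = .reject := by
  cases x <;> cases y <;> simp [combine]

lemma Std.combine_eq_reject (x y : Std) : x.combine y = .reject ↔ x = .reject ∧ y = .accept := by
  cases x <;> cases y <;> simp [combine]

end Recognition

/-! ### The language classes -/

variable (A : Type*)

lemma IsBigOTime.add {T T' t : ℕ → ℕ} (h : IsBigOTime T t) (h' : IsBigOTime T' t) :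
    IsBigOTime (fun n => T n + T' n) t := by
  have := Asymptotics.IsBigO.add h h'
  simpa only [IsBigOTime, Nat.cast_add] using this

theorem postEPTIME_eq (t : ℕ → ℕ) : PostEPTIME A t = NTIME A t ∩ co (NTIME A t) := by
  refine Set.Subset.antisymm ?_ ?_
  · rintro L ⟨M, T, hM, ht, hT, hL⟩
    refine ⟨⟨M.relabel Post.acceptOnly, T, hM.relabel _, ht, hT.relabel _, fun w => ?_⟩,
      ⟨M.relabel Post.rejectOnly, T, hM.relabel _, ht, hT.relabel _, fun w => ?_⟩⟩
    · exact (M.haltProb_relabel _ Post.eq_accept_of_acceptOnly w).symm ▸ hL.mem_iff w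
    · exact (M.haltProb_relabel _ Post.eq_reject_of_rejectOnly w).symm ▸ hL.mem_compl_iff w
  · rintro L ⟨⟨M₁, T₁, hM₁, ht₁, hT₁, hL₁⟩, ⟨M₂, T₂, hM₂, ht₂, hT₂, hL₂⟩⟩
    let M : Bool → PTM A Post := fun b =>
      bif b then M₁.relabel (Std.toPost true) else M₂.relabel (Std.toPost false)
    have hM : ∀ b, (M b).WellFormed := Bool.rec (hM₂.relabel _) (hM₁.relabel _)
    have hT : ∀ b, (M b).RunsInTime (bif b then T₁ else T₂) :=
      Bool.rec (hT₂.relabel _) (hT₁.relabel _)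
    refine ⟨PTM.choice M, _, .choice hM, ht₁.add ht₂, .choice hM hT,
      postErrorFreeRecognizes_of_nondet hL₁ hL₂ (PTM.haltProb_nonneg hM₁ _)
        (PTM.haltProb_nonneg hM₂ _) (fun w => ?_) fun w => ?_⟩
    · rw [PTM.haltProb_choice hT, show (M true).haltProb .accept w = _ from
        M₁.haltProb_relabel _ (Std.eq_accept_of_toPost true) w,
        show (M false).haltProb .accept w = _ from
        M₂.haltProb_relabel_eq_zero _ Std.toPost_false_ne_accept w, add_zero]
    · rw [PTM.haltProb_choice hT, show (M false).haltProb .reject w = _ from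
        M₂.haltProb_relabel _ (Std.eq_accept_of_toPost false) w,
        show (M true).haltProb .reject w = _ from
        M₁.haltProb_relabel_eq_zero _ Std.toPost_true_ne_reject w, zero_add]

theorem postEQTIME_eq (t : ℕ → ℕ) : PostEQTIME A t = NQTIME A t ∩ co (NQTIME A t) := by
  refine Set.Subset.antisymm ?_ ?_
  · rintro L ⟨M, T, hM, ht, hT, hL⟩
    refine ⟨⟨M.relabel Post.acceptOnly, T, hM.relabel _, ht, hT.relabel _, fun w => ?_⟩,
      ⟨M.relabel Post.rejectOnly, T, hM.relabel _, ht, hT.relabel _, fun w => ?_⟩⟩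
    · exact (M.haltProb_relabel _ Post.eq_accept_of_acceptOnly w).symm ▸ hL.mem_iff w
    · exact (M.haltProb_relabel _ Post.eq_reject_of_rejectOnly w).symm ▸ hL.mem_compl_iff w
  · rintro L ⟨⟨M₁, T₁, hM₁, ht₁, hT₁, hL₁⟩, ⟨M₂, T₂, hM₂, ht₂, hT₂, hL₂⟩⟩
    let M : Bool → QTM A Post := fun b =>
      bif b then M₁.relabel (Std.toPost true) else M₂.relabel (Std.toPost false)
    have hM : ∀ b, (M b).WellFormed := Bool.rec (hM₂.relabel _) (hM₁.relabel _)
    have hT : ∀ b, (M b).RunsInTime (bif b then T₁ else T₂) :=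
      Bool.rec (hT₂.relabel _) (hT₁.relabel _)
    refine ⟨QTM.choice M, _, .choice hM, ht₁.add ht₂, .choice hT,
      postErrorFreeRecognizes_of_nondet hL₁ hL₂ (M₁.haltProb_nonneg _)
        (M₂.haltProb_nonneg _) (fun w => ?_) fun w => ?_⟩
    · rw [QTM.haltProb_choice hT, show (M true).haltProb .accept w = _ from
        M₁.haltProb_relabel _ (Std.eq_accept_of_toPost true) w,
        show (M false).haltProb .accept w = _ from
        M₂.haltProb_relabel_eq_zero _ Std.toPost_false_ne_accept w, add_zero]
    · rw [QTM.haltProb_choice hT, show (M false).haltProb .reject w = _ from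
        M₂.haltProb_relabel _ (Std.eq_accept_of_toPost false) w,
        show (M true).haltProb .reject w = _ from
        M₁.haltProb_relabel_eq_zero _ Std.toPost_true_ne_reject w, zero_add]

theorem postES_eq : PostES A = REG A := by
  refine Set.Subset.antisymm ?_ ?_
  · rintro L ⟨M, hL⟩
    have : L = {w | 0 < M.haltProb .accept w} := Set.ext hL.mem_iff
    rw [this]
    exact M.isRegular_setOf_haltProb_pos _
  · rintro L ⟨S, _, D, rfl⟩
    refine ⟨PFA.ofDFA D, postErrorFreeRecognizes_of_pos (fun w hw => ?_) fun w hw => ?_⟩ <;>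
      rw [DFA.mem_accepts] at hw <;>
      simp [PFA.haltProb_ofDFA, hw]

theorem postEQAL_eq : PostEQAL A = NQAL A ∩ co (NQAL A) := by
  refine Set.Subset.antisymm ?_ ?_
  · rintro L ⟨M, hL⟩
    refine ⟨⟨M.relabel Post.acceptOnly, fun w => ?_⟩, ⟨M.relabel Post.rejectOnly, fun w => ?_⟩⟩
    · exact (M.haltProb_relabel Post.eq_accept_of_acceptOnly w).symm ▸ hL.mem_iff w
    · exact (M.haltProb_relabel Post.eq_reject_of_rejectOnly w).symm ▸ hL.mem_compl_iff w
  · rintro L ⟨⟨M₁, hL₁⟩, ⟨M₂, hL₂⟩⟩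
    refine ⟨.prod Std.combine M₁ M₂,
      postErrorFreeRecognizes_of_pos (fun w hw => ?_) fun w hw => ?_⟩ <;>
      rw [QFA.haltProb_prod M₁ M₂ Std.combine_eq_accept,
        QFA.haltProb_prod M₁ M₂ Std.combine_eq_reject]
    -- The second automaton rejects with certainty here, so the joint accepting weight equals the
    -- first one's acceptance probability, and the joint rejecting weight contains the factor 0.
    · have h₁ := (hL₁ w).1 hw
      have h₂ := hL₂.eq_zero (M₂.haltProb_nonneg _ w) (fun h => h hw)
      have h := M₂.haltProb_accept_add_reject w
      rw [h₂, zero_add] at h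
      rw [h₂, h, mul_one, mul_zero]
      exact ⟨h₁, rfl⟩
    · have h₁ := hL₁.eq_zero (M₁.haltProb_nonneg _ w) hw
      have h₂ := (hL₂ w).1 hw
      have h := M₁.haltProb_accept_add_reject w
      rw [h₁, zero_add] at h
      rw [h₁, h, one_mul, zero_mul]
      exact ⟨rfl, h₂⟩

end Postselection

theorem mainTheorem7 {A : Type*} [Fintype A] :
    (∀ t : ℕ → ℕ,
      Postselection.PostEPTIME A t =
        Postselection.NTIME A t ∩ Postselection.co (Postselection.NTIME A t) ∧
      Postselection.PostEQTIME A t =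
        Postselection.NQTIME A t ∩ Postselection.co (Postselection.NQTIME A t)) ∧
    Postselection.PostES A = Postselection.REG A ∧
    Postselection.PostEQAL A = Postselection.NQAL A ∩ Postselection.co (Postselection.NQAL A) :=
  ⟨fun t => ⟨Postselection.postEPTIME_eq A t, Postselection.postEQTIME_eq A t⟩,
    Postselection.postES_eq A, Postselection.postEQAL_eq A⟩
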